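/- Let $0<p\le 1$, $q=1-p$, and consider the $N$-particle asymmetric simple exclusion process (ASEP) on $\mathbb Z$: each particle waits an exponential time with mean $1$; then with probability $p$ it tries to jump one step to the right and with probability $q$ one step to the left; it jumps if the target site is unoccupied and otherwise stays put (all waiting times and choices being independent). Let $Y=\{y_1<\cdots<y_N\}\subset\mathbb Z$ be the initial configuration, let $x_1(t)<\cdots<x_N(t)$ be the positions of the particles at time $t\ge0$, and write $\mathbb P_Y$ for the probability. Put $$f(\xi,\xi')=p+q\xi\xi'-\xi,\qquad \varepsilon(\xi)=p\,\xi^{-1}+q\,\xi-1 .$$ Let $\mathcal C_r$ be the circle with center $0$ and radius $r$, where $0<r<1$ is so small that $f(\xi,\xi')\neq0$ whenever $|\xi|\le r$ and $|\xi'|\le r$. Then for $1\le m\le N$, all integers $x_1<\cdots<x_m$ and all $t\ge 0$, $$\mathbb P_Y\big(x_i(t)=x_i,\ i=1,\ldots,m\big)=\sum_{\Lambda}(-1)^{\sum_{i<m}(\ell_i-i)}\,\mathrm{sgn}\,\Lambda\;p^{(N-m+1)(N-m)/2}$$ $$\times\frac1{(2\pi i)^N}\int_{\mathcal C_r}\!\!\cdots\int_{\mathcal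 C_r}\frac{\prod_{i\in\Lambda,\,j\notin\Lambda}f(\xi_i,\xi_j)\ \prod_{i<j<m}f(\xi_{\ell_i},\xi_{\ell_j})}{\prod_{i<j}f(\xi_i,\xi_j)}\Big(1-\prod_{j\notin\Lambda}\xi_j\Big)\frac{\prod_{i<j;\ i,j\notin\Lambda}(\xi_j-\xi_i)}{\prod_{j\notin\Lambda}(1-\xi_j)}$$ $$\times\prod_{i<m}\xi_{\ell_i}^{x_i}\ \prod_{j\notin\Lambda}\xi_j^{x_m}\ \prod_{i}\xi_i^{-y_i-1}\ e^{\sum_i\varepsilon(\xi_i)t}\ d\xi_1\cdots d\xi_N .$$ The sum is over all ordered $(m-1)$-tuples $\Lambda=(\ell_1,\ldots,\ell_{m-1})$ of distinct elements of $\{1,\ldots,N\}$, so that it has $N!/(N-m+1)!$ terms; $\mathrm{sgn}\,\Lambda=(-1)^{\#\{i<j\,:\,\ell_i>\ell_j\}}$; in $i\in\Lambda$ and $j\notin\Lambda$, $\Lambda$ is regarded as a subset of $\{1,\ldots,N\}$; indices that are not further restricted run over $\{1,\ldots,N\}$. -/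

import Mathlib

open scoped NNReal Topology Nat

namespace ASEP

/-- A configuration of `N` particles on `ℤ`, listed from left to right: `x 0 < x 1 < ⋯`. -/
abbrev Config (N : ℕ) : Type := {x : Fin N → ℤ // StrictMono x}

/-- Moving one particle to an unoccupied neighbouring site keeps the order of the particles. -/
theorem strictMono_update {N : ℕ} (X : Config N) (i : Fin N) (d : ℤˣ)
    (h : ∀ j, X.1 j ≠ X.1 i + d) : StrictMono (Function.update X.1 i (X.1 i + d)) := by
  intro a b hab
  have hX := X.2 hab
  have ha := h a
  have hb := h b
  rcases Int.units_eq_one_or d with rfl | rfl <;>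
  · by_cases h1 : a = i
    · subst h1
      have h2 : b ≠ a := ne_of_gt hab
      simp [Function.update_of_ne h2] at *
      omega
    · by_cases h2 : b = i
      · subst h2
        simp [Function.update_of_ne h1] at *
        omega
      · simpa [Function.update_of_ne h1, Function.update_of_ne h2] using hX

/-- The configuration after particle `i` tries to jump by `d = ±1`: it moves if the target site
is unoccupied, and otherwise it stays put. -/
def tryJump {N : ℕ} (X : Config N) (i : Fin N) (d : ℤˣ) : Config N :=
  if h : ∀ j, X.1 j ≠ X.1 i + d then
    ⟨Function.update X.1 i (X.1 i + d), strictMono_update X i d h⟩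
  else X

/-- The generator of the `N`-particle ASEP: each particle tries to jump to the right at rate `p`
and to the left at rate `q = 1 - p`. -/
def generator {N : ℕ} (p : ℝ) (g : Config N → ℝ) : Config N → ℝ := fun X =>
  ∑ i, (p * (g (tryJump X i 1) - g X) + (1 - p) * (g (tryJump X i (-1)) - g X))

/-- The transition function `(exp (t L) 1_X) (Y)`, with `L` the generator, which is bounded for
the supremum norm (by `2 N` for `0 ≤ p ≤ 1`), so that the exponential series converges. -/
noncomputable def transition {N : ℕ} (p t : ℝ) (Y X : Config N) : ℝ :=
  ∑' n : ℕ, t ^ n / (n ! : ℝ) * ((generator p)^[n] (fun Z => if Z = X then 1 else 0)) Y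

/-- `X` is the `N`-particle ASEP with initial configuration `Y`: a Markov jump process, with
the transition function of the ASEP, started at `Y`. -/
structure IsASEP {N : ℕ} (p : ℝ) (Y : Config N) {Ω : Type*} [MeasurableSpace Ω]
    (P : MeasureTheory.Measure Ω) (X : ℝ≥0 → Ω → Config N) : Prop where
  measurable : ∀ t, Measurable (X t)
  /-- The finite-dimensional distributions. -/
  fdd : ∀ (n : ℕ) (τ : Fin (n + 1) → ℝ≥0) (s : Fin (n + 1) → Config N),
    Monotone τ → τ 0 = 0 →
      P.real {ω | ∀ j, X (τ j) ω = s j} =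
        (if s 0 = Y then 1 else 0) *
          ∏ j : Fin n, transition p ((τ j.succ : ℝ) - τ j.castSucc) (s j.castSucc) (s j.succ)
  /-- The paths are right-continuous step functions with left limits. -/
  cadlag : ∀ᵐ ω ∂P, ∀ t, (∀ᶠ u in 𝓝[>] t, X u ω = X t ω) ∧
    ∃ Z, ∀ᶠ u in 𝓝[<] t, X u ω = Z

/-- `f(ξ, ξ') = p + q ξ ξ' - ξ`, with `q = 1 - p`. -/
def f (p : ℝ) (ξ ξ' : ℂ) : ℂ := p + (1 - p) * ξ * ξ' - ξ

/-- `ε(ξ) = p ξ⁻¹ + q ξ - 1`, with `q = 1 - p`. -/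
noncomputable def ε (p : ℝ) (ξ : ℂ) : ℂ := p * ξ⁻¹ + (1 - p) * ξ - 1

/-- The sign `(-1) ^ #inversions` of an ordered tuple of distinct indices. -/
def sgn {k N : ℕ} (l : Fin k ↪ Fin N) : ℂ :=
  (-1) ^ (Finset.univ.filter fun a : Fin k × Fin k => a.1 < a.2 ∧ l a.2 < l a.1).card

/-- The indices that do not occur in the tuple `l`. -/
def compl {k N : ℕ} (l : Fin k ↪ Fin N) : Finset (Fin N) := (Finset.univ.map l)ᶜ

/-- The integrand that belongs to the tuple `l = (l 0, …, l (k - 1))`, where `k = m - 1`. The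
positions of the first `m` particles are `x 0 < ⋯ < x k`. -/
noncomputable def integrand {k N : ℕ} (p : ℝ) (y : Fin N → ℤ) (x : Fin (k + 1) → ℤ) (t : ℝ)
    (l : Fin k ↪ Fin N) (ξ : Fin N → ℂ) : ℂ :=
  ((∏ i, ∏ j ∈ compl l, f p (ξ (l i)) (ξ j)) * ∏ i, ∏ j ∈ Finset.Ioi i, f p (ξ (l i)) (ξ (l j))) /
      (∏ i, ∏ j ∈ Finset.Ioi i, f p (ξ i) (ξ j)) *
    (1 - ∏ j ∈ compl l, ξ j) *
    ((∏ i ∈ compl l, ∏ j ∈ compl l with i < j, (ξ j - ξ i)) / ∏ j ∈ compl l, (1 - ξ j)) *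
    (∏ i, ξ (l i) ^ x i.castSucc) *
    (∏ j ∈ compl l, ξ j ^ x (Fin.last k)) *
    (∏ i, ξ i ^ (-y i - 1)) *
    Complex.exp ((∑ i, ε p (ξ i)) * t)

/-- The `N`-fold contour integral over the circle with center `0` and radius `r` in each
variable, with a factor `1 / (2 π i)` for each integration. -/
noncomputable def contour {N : ℕ} (r : ℝ) (g : (Fin N → ℂ) → ℂ) : ℂ :=
  (1 / (2 * Real.pi * Complex.I)) ^ N * torusIntegral g 0 (fun _ => r)

end ASEP

/-! The probability of an event `A` at time `t` is `∑ tⁿ/n! (Lⁿ 1_A)(Y)`, with `L` the generator, so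
it suffices to write every `Lⁿ 1_A` as a contour integral. This is a Bethe ansatz in the initial
configuration `y`. The function `∏ ξ_i ^ (-y_i - 1)` is an eigenfunction of the free generator, in
which particles ignore each other, with eigenvalue `∑ ε(ξ_i)`. Divided by `∏_{i<j} f(ξ_i, ξ_j)` and
integrated against an antisymmetric function, it also satisfies the boundary conditions under which
the free generator agrees with `L` (`transform_boundary`, `generator_eq_sum_free`). Hence applying
`L` multiplies the integrand by `∑ ε(ξ_i)`, and only the case `n = 0` remains
(`iterate_generator_eq_transform`).

For `n = 0` with all positions prescribed, the kernel must be the identity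
(`transform_asym_bethe_self`). The kernel satisfies boundary conditions in `x` as well as in `y`, so
it commutes with `L`; so does its difference `deviation` from the identity. If `y 0 < x i` for all
`i ≠ 0`, Cauchy's theorem and a residue in `ξ 0` reduce the number of particles by one. Otherwise,
by induction on `y 0 - x 0`, the commutation relation shows that the deviation is unchanged when
both `x 0` and `y 0` move one step to the left, which leads to the former case.

When only the first particles are prescribed, the others are summed out one at a time. An identity
of Lagrange interpolation type (`sum_prod_f_div_sub`) shows that the kernel for `k` prescribed
particles, minus its copy with the remaining positions shifted by one, is `N - k` times the kernel
for `k + 1` (`asym_bethe_sub`); this telescopes (`transform_asym_bethe`). The same difference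
produces the factor `1 - ∏ ξ_j` of the integrand. Finally the sum over permutations is grouped by
the images of the first `k` indices, which gives the sum over ordered tuples. -/

namespace ASEP

open MeasureTheory Set Filter

/-! ### Contour integrals over the torus. -/

/-- The torus `{ξ : ‖ξ i‖ = r}` over which contour integrals are taken. -/
def torus (N : ℕ) (r : ℝ) : Set (Fin N → ℂ) := {ξ | ∀ i, ‖ξ i‖ = r}

theorem torusMap_mem_torus {N : ℕ} {r : ℝ} (hr : 0 ≤ r) (θ : Fin N → ℝ) :
    torusMap 0 (fun _ => r) θ ∈ torus N r := fun i => by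
  simp [torusMap, abs_of_nonneg hr]

theorem torus_ne_zero {N : ℕ} {r : ℝ} (hr : 0 < r) {ξ : Fin N → ℂ} (h : ξ ∈ torus N r)
    (i : Fin N) : ξ i ≠ 0 := by
  rw [← norm_pos_iff, h i]; exact hr

theorem torus_comp {N : ℕ} {r : ℝ} {ξ : Fin N → ℂ} (h : ξ ∈ torus N r)
    (σ : Equiv.Perm (Fin N)) : ξ ∘ σ ∈ torus N r := fun i => h (σ i)

theorem isCompact_torus (N : ℕ) (r : ℝ) : IsCompact (torus N r) := by
  have : torus N r = Set.pi univ (fun _ => Metric.sphere (0 : ℂ) r) := by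
    ext ξ; simp [torus, Set.mem_pi]
  rw [this]
  exact isCompact_univ_pi fun _ => isCompact_sphere _ _

theorem torusIntegrable_of_continuousOn {N : ℕ} {r : ℝ} (hr : 0 ≤ r) {g : (Fin N → ℂ) → ℂ}
    (hg : ContinuousOn g (torus N r)) : TorusIntegrable g 0 (fun _ => r) := by
  have hc : Continuous fun θ : Fin N → ℝ => g (torusMap 0 (fun _ => r) θ) := by
    refine hg.comp_continuous ?_ (torusMap_mem_torus hr)
    unfold torusMap
    fun_prop
  exact hc.continuousOn.integrableOn_compact isCompact_Icc

theorem contour_congr {N : ℕ} {r : ℝ} (hr : 0 ≤ r) {g h : (Fin N → ℂ) → ℂ}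
    (H : EqOn g h (torus N r)) : contour r g = contour r h := by
  unfold contour torusIntegral
  congr 1
  refine integral_congr_ae (Eventually.of_forall fun θ => ?_)
  simp only [H (torusMap_mem_torus hr θ)]

theorem contour_const_mul {N : ℕ} (r : ℝ) (a : ℂ) (g : (Fin N → ℂ) → ℂ) :
    contour r (fun ξ => a * g ξ) = a * contour r g := by
  unfold contour
  rw [torusIntegral_const_mul]
  ring

theorem contour_add {N : ℕ} {r : ℝ} (hr : 0 ≤ r) {g h : (Fin N → ℂ) → ℂ}
    (hg : ContinuousOn g (torus N r)) (hh : ContinuousOn h (torus N r)) :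
    contour r (fun ξ => g ξ + h ξ) = contour r g + contour r h := by
  unfold contour
  rw [torusIntegral_add (torusIntegrable_of_continuousOn hr hg)
    (torusIntegrable_of_continuousOn hr hh)]
  ring

theorem contour_neg {N : ℕ} (r : ℝ) (g : (Fin N → ℂ) → ℂ) :
    contour r (fun ξ => -g ξ) = -contour r g := by
  simpa using contour_const_mul r (-1) g

theorem contour_zero {N : ℕ} (r : ℝ) : contour r (fun _ : Fin N → ℂ => 0) = 0 := by
  simpa using contour_const_mul r 0 (fun _ : Fin N → ℂ => 0)

theorem contour_sum {N : ℕ} {r : ℝ} (hr : 0 ≤ r) {ι : Type*} (s : Finset ι)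
    {g : ι → (Fin N → ℂ) → ℂ} (hg : ∀ i ∈ s, ContinuousOn (g i) (torus N r)) :
    contour r (fun ξ => ∑ i ∈ s, g i ξ) = ∑ i ∈ s, contour r (g i) := by
  classical
  induction s using Finset.induction_on with
  | empty => simpa using contour_zero r
  | insert a s ha ih =>
    simp only [Finset.sum_insert ha]
    rw [contour_add hr (hg a (by simp)), ih fun i hi => hg i (by simp [hi])]
    exact continuousOn_finsetSum _ fun i hi => hg i (by simp [hi])

theorem contour_comp_perm {N : ℕ} (r : ℝ) (σ : Equiv.Perm (Fin N)) (g : (Fin N → ℂ) → ℂ) :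
    contour r (fun ξ => g (ξ ∘ σ)) = contour r g := by
  unfold contour torusIntegral
  congr 1
  let e := MeasurableEquiv.piCongrLeft (fun _ : Fin N => ℝ) σ⁻¹
  have hem : MeasurePreserving e := volume_measurePreserving_piCongrLeft (fun _ => ℝ) σ⁻¹
  have he : ∀ θ : Fin N → ℝ, e θ = θ ∘ σ := by
    intro θ
    ext i
    have := MeasurableEquiv.piCongrLeft_apply_apply (β := fun _ : Fin N => ℝ) (e := σ⁻¹) θ (σ i)
    simpa [e] using this
  have hpre : e ⁻¹' (Icc 0 fun _ => 2 * Real.pi) = Icc 0 fun _ => 2 * Real.pi := by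
    ext θ
    simp only [mem_preimage, he, mem_Icc, Pi.le_def, Function.comp_apply, Pi.zero_apply]
    exact ⟨fun h => ⟨fun i => by simpa using h.1 (σ⁻¹ i), fun i => by simpa using h.2 (σ⁻¹ i)⟩,
      fun h => ⟨fun i => h.1 _, fun i => h.2 _⟩⟩
  conv_rhs => rw [← hem.setIntegral_preimage_emb e.measurableEmbedding, hpre]
  refine integral_congr_ae (Eventually.of_forall fun θ => ?_)
  simp only [he]
  congr 1
  exact (Equiv.prod_comp σ fun i => (r * Complex.exp (θ i * Complex.I) * Complex.I : ℂ)).symm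

/-- The chosen variable is integrated innermost, so that Cauchy's theorem applies for each fixed
value of the others. -/
theorem torusIntegral_succAbove_symm {n : ℕ} {f : (Fin (n + 1) → ℂ) → ℂ} {r : ℝ}
    (hf : TorusIntegrable f 0 (fun _ => r)) (i : Fin (n + 1)) :
    torusIntegral f 0 (fun _ => r) =
      torusIntegral (fun y => ∮ x in C(0, r), f (i.insertNth x y)) 0 (fun _ : Fin n => r) := by
  set e : ℝ × (Fin n → ℝ) ≃ᵐ (Fin (n + 1) → ℝ) :=
    (MeasurableEquiv.piFinSuccAbove (fun _ => ℝ) i).symm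
  have hem : MeasurePreserving e :=
    (volume_preserving_piFinSuccAbove (fun _ : Fin (n + 1) => ℝ) i).symm _
  have heπ : (e ⁻¹' Icc 0 fun _ => 2 * Real.pi) =
      Icc 0 (2 * Real.pi) ×ˢ Icc (0 : Fin n → ℝ) fun _ => 2 * Real.pi :=
    ((Fin.insertNthOrderIso (fun _ => ℝ) i).preimage_Icc _ _).trans (Icc_prod_eq _ _)
  have hint := hf.function_integrable
  rw [← hem.integrableOn_comp_preimage e.measurableEmbedding, heπ] at hint
  rw [torusIntegral, ← hem.map_eq, setIntegral_map_equiv, heπ, Measure.volume_eq_prod,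
    ← setIntegral_prod_swap, setIntegral_prod]
  · rw [torusIntegral]
    refine setIntegral_congr_fun measurableSet_Icc fun Θ _ => ?_
    simp only [circleIntegral_def_Icc, ← integral_smul]
    refine setIntegral_congr_fun measurableSet_Icc fun θ _ => ?_
    have h1 : torusMap 0 (fun _ => r) (e (θ, Θ)) =
        i.insertNth (circleMap 0 r θ) (torusMap 0 (fun _ => r) Θ) := by
      simp only [funext_iff, i.forall_iff_succAbove]
      simp [e, torusMap, circleMap, MeasurableEquiv.piFinSuccAbove_symm_apply, Fin.insertNthEquiv]
    have h2 : (∏ j, (r * Complex.exp (e (θ, Θ) j * Complex.I) * Complex.I : ℂ)) =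
        deriv (circleMap 0 r) θ *
          ∏ j : Fin n, (r * Complex.exp (Θ j * Complex.I) * Complex.I : ℂ) := by
      rw [i.prod_univ_succAbove]
      simp [e, circleMap, MeasurableEquiv.piFinSuccAbove_symm_apply, Fin.insertNthEquiv]
    simp only [Prod.swap_prod_mk, h1, h2, smul_eq_mul]
    ring
  · exact hint.swap

theorem contour_eq_zero {N : ℕ} {r : ℝ} (hr : 0 < r) (a : Fin N) {g : (Fin N → ℂ) → ℂ}
    (hg : ContinuousOn g (torus N r)) (H : (Fin N → ℂ) → ℂ) (hgH : EqOn g H (torus N r))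
    (hH : ∀ ξ ∈ torus N r,
      DifferentiableOn ℂ (fun z => H (Function.update ξ a z)) (Metric.closedBall 0 r)) :
    contour r g = 0 := by
  rcases N with _ | n
  · exact a.elim0
  rw [contour, torusIntegral_succAbove_symm (torusIntegrable_of_continuousOn hr.le hg) a]
  have : (torusIntegral (fun y => ∮ x in C(0, r), g (a.insertNth x y)) 0
      (fun _ : Fin n => r)) = torusIntegral (fun y => (0 : ℂ)) 0 (fun _ : Fin n => r) := by
    unfold torusIntegral
    refine integral_congr_ae (Eventually.of_forall fun θ => ?_)
    set y : Fin n → ℂ := torusMap 0 (fun _ => r) θ with hy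
    have hyt : ∀ z : ℂ, ‖z‖ = r → (a.insertNth z y : Fin (n + 1) → ℂ) ∈ torus (n + 1) r := by
      intro z hz
      unfold torus
      rw [mem_ofPred_eq, a.forall_iff_succAbove]
      exact ⟨by simpa using hz, fun i => by simpa using torusMap_mem_torus hr.le θ i⟩
    have h0 : (∮ x in C(0, r), g (a.insertNth x y)) = 0 := by
      have hd := hH (a.insertNth (r : ℂ) y) (hyt r (by simp [abs_of_pos hr]))
      simp only [Fin.update_insertNth] at hd
      rw [circleIntegral.integral_congr hr.le (g := fun x => H (a.insertNth x y))
        fun z hz => hgH (hyt z (by simpa using hz))]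
      exact (hd.diffContOnCl_ball subset_rfl).circleIntegral_eq_zero hr.le
    beta_reduce
    rw [h0]
  rw [this]
  simp [torusIntegral]

theorem contour_cons_zpow {n : ℕ} {r : ℝ} (hr : 0 < r) (m : ℤ) {h : (Fin n → ℂ) → ℂ}
    (hh : ContinuousOn h (torus n r)) :
    contour r (fun ξ : Fin (n + 1) → ℂ => ξ 0 ^ m * h (Fin.tail ξ)) =
      (if m = -1 then 1 else 0) * contour r h := by
  have hc : ContinuousOn (fun ξ : Fin (n + 1) → ℂ => ξ 0 ^ m * h (Fin.tail ξ))
      (torus (n + 1) r) := by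
    refine ContinuousOn.mul ?_ (hh.comp (by unfold Fin.tail; fun_prop) fun ξ hξ i => hξ i.succ)
    exact ContinuousOn.zpow₀ (by fun_prop) m fun ξ hξ => Or.inl (torus_ne_zero hr hξ 0)
  rw [contour, torusIntegral_succ (torusIntegrable_of_continuousOn hr.le hc)]
  have h1 : ∀ x : ℂ, torusIntegral (fun y => (Fin.cons x y : Fin (n + 1) → ℂ) 0 ^ m *
      h (Fin.tail (Fin.cons x y : Fin (n + 1) → ℂ))) ((0 : Fin (n + 1) → ℂ) ∘ Fin.succ)
      ((fun _ : Fin (n + 1) => r) ∘ Fin.succ) =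
      x ^ m * torusIntegral h 0 (fun _ => r) := by
    intro x
    rw [← torusIntegral_const_mul]
    rfl
  simp only [h1]
  have h2 : (∮ x in C((0 : Fin (n + 1) → ℂ) 0, r), x ^ m * torusIntegral h 0 (fun _ => r)) =
      (∮ x in C(0, r), (x - 0) ^ m) * torusIntegral h 0 (fun _ => r) := by
    simp only [sub_zero, Pi.zero_apply]
    simp [circleIntegral, ← intervalIntegral.integral_mul_const, mul_assoc]
  rw [h2, contour]
  split_ifs with hm
  · subst hm
    simp only [zpow_neg_one]
    rw [circleIntegral.integral_sub_inv_of_mem_ball (by simpa using hr)]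
    have : (2 * Real.pi * Complex.I : ℂ) ≠ 0 := by simp [Real.pi_ne_zero]
    rw [pow_succ]
    linear_combination (1 / (2 * Real.pi * Complex.I)) ^ n * torusIntegral h 0 (fun _ => r) *
      one_div_mul_cancel this
  · rw [circleIntegral.integral_sub_zpow_of_ne hm]
    simp

theorem contour_of_isEmpty (r : ℝ) (g : (Fin 0 → ℂ) → ℂ) : contour r g = g 0 := by
  simp [contour]

/-- Since `s` is bounded on the compact torus by some `M`, the exponential series is dominated by
that of `|t| M` and may be integrated term by term. -/
theorem hasSum_contour_exp {N : ℕ} {r : ℝ} (hr : 0 ≤ r) {h s : (Fin N → ℂ) → ℂ}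
    (hh : ContinuousOn h (torus N r)) (hs : ContinuousOn s (torus N r)) (t : ℝ) :
    HasSum (fun n : ℕ => ((t ^ n / (n ! : ℝ) : ℝ) : ℂ) * contour r (fun ξ => s ξ ^ n * h ξ))
      (contour r fun ξ => h ξ * Complex.exp (s ξ * t)) := by
  obtain ⟨M, hM⟩ := (isCompact_torus N r).exists_bound_of_continuousOn hs
  have key : HasSum (fun n : ℕ => torusIntegral
      (fun ξ => ((t ^ n / (n ! : ℝ) : ℝ) : ℂ) * (s ξ ^ n * h ξ)) 0 (fun _ => r))
      (torusIntegral (fun ξ => h ξ * Complex.exp (s ξ * t)) 0 (fun _ => r)) := by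
    unfold torusIntegral
    have hc : ∀ {u : (Fin N → ℂ) → ℂ}, ContinuousOn u (torus N r) → Continuous fun θ : Fin N → ℝ =>
        (∏ i : Fin N, (r * Complex.exp (θ i * Complex.I) * Complex.I : ℂ)) •
          u (torusMap 0 (fun _ => r) θ) := by
      intro u hu
      have h1 : Continuous fun θ : Fin N → ℝ =>
          (∏ i : Fin N, (r * Complex.exp (θ i * Complex.I) * Complex.I : ℂ)) := by fun_prop
      refine h1.smul (hu.comp_continuous ?_ (torusMap_mem_torus hr))
      unfold torusMap
      fun_prop
    have hch := (hc hh).norm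
    refine hasSum_integral_of_dominated_convergence
      (bound := fun n θ => (|t| * M) ^ n / (n ! : ℝ) *
        ‖(∏ i : Fin N, (r * Complex.exp (θ i * Complex.I) * Complex.I : ℂ)) •
          h (torusMap 0 (fun _ => r) θ)‖) ?_ ?_ ?_ ?_ ?_
    · intro n
      exact (hc (continuousOn_const.mul ((hs.pow n).mul hh))).aestronglyMeasurable
    · intro n
      refine Eventually.of_forall fun θ => ?_
      have hb := hM _ (torusMap_mem_torus hr θ)
      simp only [norm_smul, norm_mul, norm_pow, Complex.norm_real, Real.norm_eq_abs, abs_div,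
        abs_pow, Nat.abs_cast, mul_pow]
      have : ‖s (torusMap 0 (fun _ => r) θ)‖ ^ n ≤ M ^ n := by gcongr
      calc _ = |t| ^ n / (n ! : ℝ) * ‖s (torusMap 0 (fun _ => r) θ)‖ ^ n *
            (‖∏ i : Fin N, (r * Complex.exp (θ i * Complex.I) * Complex.I : ℂ)‖ *
              ‖h (torusMap 0 (fun _ => r) θ)‖) := by ring
        _ ≤ |t| ^ n / (n ! : ℝ) * M ^ n *
            (‖∏ i : Fin N, (r * Complex.exp (θ i * Complex.I) * Complex.I : ℂ)‖ *
              ‖h (torusMap 0 (fun _ => r) θ)‖) := by gcongr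
        _ = _ := by ring
    · exact Eventually.of_forall fun θ => (Real.summable_pow_div_factorial _).mul_right _
    · simp_rw [tsum_mul_right]
      exact (continuous_const.mul hch).continuousOn.integrableOn_compact isCompact_Icc
    · refine Eventually.of_forall fun θ => ?_
      have := NormedSpace.expSeries_div_hasSum_exp (𝔸 := ℂ) (s (torusMap 0 (fun _ => r) θ) * t)
      rw [← Complex.exp_eq_exp_ℂ] at this
      have := (this.mul_left ((∏ i : Fin N, (r * Complex.exp (θ i * Complex.I) * Complex.I : ℂ)) *
        h (torusMap 0 (fun _ => r) θ)))
      rw [show ∀ a b c : ℂ, a • (b * c) = a * b * c from fun a b c => by simp [mul_assoc]]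
      refine this.congr_fun fun n => ?_
      simp only [smul_eq_mul]
      push_cast
      ring
  have := key.mul_left ((1 / (2 * Real.pi * Complex.I)) ^ N)
  refine this.congr_fun fun n => ?_
  rw [← contour_const_mul]
  rfl

/-! ### The exclusion rule as a boundary condition for the free generator. -/

theorem strictMono_add_single_castSucc {n : ℕ} {y : Fin (n + 1) → ℤ} (hy : StrictMono y)
    (j : Fin n) : StrictMono (y + Pi.single j.castSucc 1) ↔ y j.succ ≠ y j.castSucc + 1 := by
  rw [Fin.strictMono_iff_lt_succ]
  rw [Fin.strictMono_iff_lt_succ] at hy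
  constructor
  · intro h
    have := h j
    simp [Fin.ext_iff] at this
    omega
  · intro h i
    have h1 := hy i
    have h2 := hy j
    simp only [Pi.add_apply, Pi.single_apply, Fin.ext_iff, Fin.val_castSucc, Fin.val_succ]
    by_cases hij : i = j
    · subst hij
      simp
      omega
    · have : (i : ℕ) ≠ j := fun h => hij (Fin.ext h)
      split_ifs <;> omega

theorem strictMono_sub_single_succ {n : ℕ} {y : Fin (n + 1) → ℤ} (hy : StrictMono y)
    (j : Fin n) : StrictMono (y - Pi.single j.succ 1) ↔ y j.succ ≠ y j.castSucc + 1 := by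
  rw [Fin.strictMono_iff_lt_succ]
  rw [Fin.strictMono_iff_lt_succ] at hy
  constructor
  · intro h
    have := h j
    simp [Fin.ext_iff] at this
    omega
  · intro h i
    have h1 := hy i
    have h2 := hy j
    simp only [Pi.sub_apply, Pi.single_apply, Fin.ext_iff, Fin.val_castSucc, Fin.val_succ]
    by_cases hij : i = j
    · subst hij
      simp
      omega
    · have : (i : ℕ) ≠ j := fun h => hij (Fin.ext h)
      split_ifs <;> omega

theorem strictMono_add_single_last {n : ℕ} {y : Fin (n + 1) → ℤ} (hy : StrictMono y) :
    StrictMono (y + Pi.single (Fin.last n) 1) := by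
  rw [Fin.strictMono_iff_lt_succ] at *
  intro i
  have := hy i
  have := i.isLt
  simp only [Pi.add_apply, Pi.single_apply, Fin.ext_iff, Fin.val_castSucc, Fin.val_succ,
    Fin.val_last]
  rw [if_neg (ne_of_lt ‹(i : ℕ) < n›)]
  split_ifs <;> omega

theorem strictMono_sub_single_zero {n : ℕ} {y : Fin (n + 1) → ℤ} (hy : StrictMono y) :
    StrictMono (y - Pi.single 0 1) := by
  rw [Fin.strictMono_iff_lt_succ] at *
  intro i
  have := hy i
  simp only [Pi.sub_apply, Pi.single_apply, Fin.ext_iff, Fin.val_castSucc, Fin.val_succ,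
    Fin.val_zero]
  rw [if_neg (Nat.succ_ne_zero _)]
  split_ifs <;> linarith

/-- The number of pairs of particles on neighbouring sites. -/
def adjacentPairs {n : ℕ} (y : Fin (n + 1) → ℤ) : ℕ :=
  (Finset.univ.filter fun j : Fin n => y j.succ = y j.castSucc + 1).card

/-- `a` and `b` are jump rates to the right and to the left: a function that satisfies the boundary
conditions turns the free generator into the generator with exclusion. -/
theorem sum_free_eq_sum_exclusion {n : ℕ} {y : Fin (n + 1) → ℤ} (hy : StrictMono y) (a b : ℂ)
    (g : (Fin (n + 1) → ℤ) → ℂ)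
    (hbc : ∀ j : Fin n, y j.succ = y j.castSucc + 1 →
      a * g (y + Pi.single j.castSucc 1) + b * g (y - Pi.single j.succ 1) = g y) :
    ∑ i, (a * g (y + Pi.single i 1) + b * g (y - Pi.single i 1)) =
      ∑ i, (a * (open Classical in if StrictMono (y + Pi.single i 1) then
          g (y + Pi.single i 1) else 0) +
        b * (open Classical in if StrictMono (y - Pi.single i 1) then
          g (y - Pi.single i 1) else 0)) + adjacentPairs y * g y := by
  classical
  -- The last particle is never blocked on its right, nor the first on its left. The remaining right
  -- jumps of `j.castSucc` and left jumps of `j.succ` pair up: both are blocked exactly when the two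
  -- particles are adjacent, and then the boundary condition evaluates their weighted sum.
  have e1 := Fin.sum_univ_castSucc fun i : Fin (n + 1) => a * g (y + Pi.single i 1)
  have e2 := Fin.sum_univ_succ fun i : Fin (n + 1) => b * g (y - Pi.single i 1)
  have e3 := Fin.sum_univ_castSucc fun i : Fin (n + 1) =>
    a * (if StrictMono (y + Pi.single i 1) then g (y + Pi.single i 1) else 0)
  have e4 := Fin.sum_univ_succ fun i : Fin (n + 1) =>
    b * (if StrictMono (y - Pi.single i 1) then g (y - Pi.single i 1) else 0)
  rw [Finset.sum_add_distrib, Finset.sum_add_distrib, e1, e2, e3, e4]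
  simp only [strictMono_add_single_last hy, strictMono_sub_single_zero hy,
    strictMono_add_single_castSucc hy, strictMono_sub_single_succ hy, if_true]
  have key : ∑ j : Fin n, (a * g (y + Pi.single j.castSucc 1) + b * g (y - Pi.single j.succ 1)) =
      ∑ j : Fin n, (a * (if y j.succ ≠ y j.castSucc + 1 then g (y + Pi.single j.castSucc 1) else 0)
        + b * (if y j.succ ≠ y j.castSucc + 1 then g (y - Pi.single j.succ 1) else 0)) +
        adjacentPairs y * g y := by
    rw [adjacentPairs, Finset.card_filter, Nat.cast_sum, Finset.sum_mul, ← Finset.sum_add_distrib]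
    refine Finset.sum_congr rfl fun j _ => ?_
    by_cases h : y j.succ = y j.castSucc + 1
    · simp [h, hbc j h]
    · simp [h]
  rw [Finset.sum_add_distrib, Finset.sum_add_distrib] at key
  linear_combination key

theorem tryJump_one {N : ℕ} (Y : Config N) (i : Fin N)
    (h : StrictMono (Y.1 + Pi.single i 1)) : tryJump Y i 1 = ⟨Y.1 + Pi.single i 1, h⟩ := by
  have e : Y.1 + Pi.single i 1 = Function.update Y.1 i (Y.1 i + 1) := by
    ext j
    by_cases hj : j = i
    · subst hj; simp
    · simp [hj]
  have h1 : ∀ j, Y.1 j ≠ Y.1 i + ((1 : ℤˣ) : ℤ) := by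
    intro j hj
    have hne : j ≠ i := by rintro rfl; simp at hj
    have := h.injective.ne hne
    simp [hne] at this
    simp at hj
    exact this hj
  rw [tryJump, dif_pos h1]
  exact Subtype.ext e.symm

theorem tryJump_one_of_not {N : ℕ} (Y : Config N) (i : Fin N)
    (h : ¬ StrictMono (Y.1 + Pi.single i 1)) : tryJump Y i 1 = Y := by
  have e : Y.1 + Pi.single i 1 = Function.update Y.1 i (Y.1 i + 1) := by
    ext j
    by_cases hj : j = i
    · subst hj; simp
    · simp [hj]
  rw [tryJump, dif_neg]
  intro h1
  exact h (e ▸ strictMono_update Y i 1 h1)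

theorem tryJump_neg_one {N : ℕ} (Y : Config N) (i : Fin N)
    (h : StrictMono (Y.1 - Pi.single i 1)) : tryJump Y i (-1) = ⟨Y.1 - Pi.single i 1, h⟩ := by
  have e : Y.1 - Pi.single i 1 = Function.update Y.1 i (Y.1 i + -1) := by
    ext j
    by_cases hj : j = i
    · subst hj; simp; ring
    · simp [hj]
  have h1 : ∀ j, Y.1 j ≠ Y.1 i + ((-1 : ℤˣ) : ℤ) := by
    intro j hj
    have hne : j ≠ i := by rintro rfl; simp at hj
    have := h.injective.ne hne
    simp [hne] at this
    simp at hj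
    exact this (by omega)
  rw [tryJump, dif_pos h1]
  exact Subtype.ext e.symm

theorem tryJump_neg_one_of_not {N : ℕ} (Y : Config N) (i : Fin N)
    (h : ¬ StrictMono (Y.1 - Pi.single i 1)) : tryJump Y i (-1) = Y := by
  have e : Y.1 - Pi.single i 1 = Function.update Y.1 i (Y.1 i + -1) := by
    ext j
    by_cases hj : j = i
    · subst hj; simp; ring
    · simp [hj]
  rw [tryJump, dif_neg]
  intro h1
  exact h (e ▸ strictMono_update Y i (-1) h1)

theorem sum_strictMono_add_single {n : ℕ} {y : Fin (n + 1) → ℤ} (hy : StrictMono y) :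
    ∑ i, (open Classical in if StrictMono (y + Pi.single i 1) then (1 : ℂ) else 0) =
      (n + 1 : ℂ) - adjacentPairs y := by
  -- A constant function satisfies the boundary condition for the rates `1, 0`, so the comparison of
  -- the two generators counts the allowed jumps.
  have := sum_free_eq_sum_exclusion hy 1 0 (fun _ => 1) (by simp)
  simp at this ⊢
  linear_combination -this

theorem sum_strictMono_sub_single {n : ℕ} {y : Fin (n + 1) → ℤ} (hy : StrictMono y) :
    ∑ i, (open Classical in if StrictMono (y - Pi.single i 1) then (1 : ℂ) else 0) =
      (n + 1 : ℂ) - adjacentPairs y := by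
  have := sum_free_eq_sum_exclusion hy 0 1 (fun _ => 1) (by simp)
  simp at this ⊢
  linear_combination -this

/-- A blocked jump contributes zero to the generator. In each direction as many jumps are blocked as
there are adjacent pairs, and `p + (1 - p) = 1`; the resulting diagonal term is the one that the
boundary conditions supply. -/
theorem generator_eq_sum_free {n : ℕ} (p : ℝ) (Y : Config (n + 1)) (g : Config (n + 1) → ℝ)
    (G : (Fin (n + 1) → ℤ) → ℂ) (hG : ∀ Z : Config (n + 1), (g Z : ℂ) = G Z.1)
    (hbc : ∀ j : Fin n, Y.1 j.succ = Y.1 j.castSucc + 1 →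
      (p : ℂ) * G (Y.1 + Pi.single j.castSucc 1) + (1 - p) * G (Y.1 - Pi.single j.succ 1) =
        G Y.1) :
    ((generator p g Y : ℝ) : ℂ) =
      ∑ i, (p * G (Y.1 + Pi.single i 1) + (1 - p) * G (Y.1 - Pi.single i 1) - G Y.1) := by
  classical
  rw [Finset.sum_sub_distrib, sum_free_eq_sum_exclusion Y.2 _ _ G hbc]
  have h1 : ∀ i, ((g (tryJump Y i 1) : ℝ) : ℂ) = (if StrictMono (Y.1 + Pi.single i 1) then
      G (Y.1 + Pi.single i 1) else 0) +
      (1 - (if StrictMono (Y.1 + Pi.single i 1) then 1 else 0)) * G Y.1 := by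
    intro i
    split_ifs with h
    · rw [tryJump_one Y i h, hG]; simp
    · rw [tryJump_one_of_not Y i h, hG]; simp
  have h2 : ∀ i, ((g (tryJump Y i (-1)) : ℝ) : ℂ) = (if StrictMono (Y.1 - Pi.single i 1) then
      G (Y.1 - Pi.single i 1) else 0) +
      (1 - (if StrictMono (Y.1 - Pi.single i 1) then 1 else 0)) * G Y.1 := by
    intro i
    split_ifs with h
    · rw [tryJump_neg_one Y i h, hG]; simp
    · rw [tryJump_neg_one_of_not Y i h, hG]; simp
  have e : ((generator p g Y : ℝ) : ℂ) = ∑ i, ((p * (if StrictMono (Y.1 + Pi.single i 1) then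
      G (Y.1 + Pi.single i 1) else 0) + (1 - p) * (if StrictMono (Y.1 - Pi.single i 1) then
      G (Y.1 - Pi.single i 1) else 0)) -
      (p * G Y.1) * (if StrictMono (Y.1 + Pi.single i 1) then 1 else 0) -
      ((1 - p) * G Y.1) * (if StrictMono (Y.1 - Pi.single i 1) then 1 else 0)) := by
    unfold generator
    push_cast
    refine Finset.sum_congr rfl fun i _ => ?_
    rw [h1, h2, hG]
    ring
  rw [e, Finset.sum_sub_distrib, Finset.sum_sub_distrib, ← Finset.mul_sum, ← Finset.mul_sum,
    sum_strictMono_add_single Y.2, sum_strictMono_sub_single Y.2]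
  simp
  ring

/-! ### The exponential series of the generator and the law of the process. -/

/-- A bound on the absolute row sums of the matrix of `Lⁿ`: each application of the generator costs
at most a factor `2 N`. It justifies exchanging the sum over final configurations with the
exponential series. -/
theorem sum_abs_generator_iterate_le {N : ℕ} {p : ℝ} (hp0 : 0 ≤ p) (hp1 : p ≤ 1)
    (S : Finset (Config N)) (n : ℕ) (Y : Config N) :
    ∑ Z ∈ S, |(generator p)^[n] (fun W => if W = Z then 1 else 0) Y| ≤ (2 * N : ℝ) ^ n := by
  induction n generalizing Y with
  | zero =>
    simp only [Function.iterate_zero, id, pow_zero]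
    calc _ = ∑ Z ∈ S, if Y = Z then (1 : ℝ) else 0 :=
          Finset.sum_congr rfl fun Z _ => by split_ifs <;> simp
      _ ≤ 1 := by rw [Finset.sum_ite_eq]; split_ifs <;> simp
  | succ n ih =>
    simp only [Function.iterate_succ_apply']
    set a : Config N → Config N → ℝ :=
      fun W Z => (generator p)^[n] (fun W => if W = Z then 1 else 0) W with ha
    calc _ = ∑ Z ∈ S, |∑ i, (p * (a (tryJump Y i 1) Z - a Y Z) +
              (1 - p) * (a (tryJump Y i (-1)) Z - a Y Z))| := rfl
      _ ≤ ∑ Z ∈ S, ∑ i, (p * (|a (tryJump Y i 1) Z| + |a Y Z|) +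
              (1 - p) * (|a (tryJump Y i (-1)) Z| + |a Y Z|)) := by
          refine Finset.sum_le_sum fun Z _ => (Finset.abs_sum_le_sum_abs _ _).trans ?_
          refine Finset.sum_le_sum fun i _ => (abs_add_le _ _).trans ?_
          rw [abs_mul, abs_mul, abs_of_nonneg hp0, abs_of_nonneg (sub_nonneg.2 hp1)]
          have : 0 ≤ 1 - p := sub_nonneg.2 hp1
          gcongr <;> exact abs_sub _ _
      _ = ∑ i : Fin N, (p * (∑ Z ∈ S, |a (tryJump Y i 1) Z| + ∑ Z ∈ S, |a Y Z|) +
              (1 - p) * (∑ Z ∈ S, |a (tryJump Y i (-1)) Z| + ∑ Z ∈ S, |a Y Z|)) := by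
          rw [Finset.sum_comm]
          simp only [Finset.sum_add_distrib, Finset.mul_sum, mul_add]
      _ ≤ ∑ i : Fin N, (p * ((2 * N : ℝ) ^ n + (2 * N : ℝ) ^ n) +
              (1 - p) * ((2 * N : ℝ) ^ n + (2 * N : ℝ) ^ n)) := by
          have : 0 ≤ 1 - p := sub_nonneg.2 hp1
          refine Finset.sum_le_sum fun i _ => ?_
          gcongr <;> exact ih _
      _ = _ := by
          rw [Finset.sum_const, Finset.card_univ, Fintype.card_fin, nsmul_eq_mul, pow_succ]
          ring

theorem hasSum_generator_iterate {N : ℕ} {p : ℝ} (A : Set (Config N)) [DecidablePred (· ∈ A)]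
    (n : ℕ) (Y : Config N) :
    HasSum (fun Z : Config N => (if Z ∈ A then 1 else 0) *
        (generator p)^[n] (fun W => if W = Z then 1 else 0) Y)
      ((generator p)^[n] (fun W => if W ∈ A then 1 else 0) Y) := by
  induction n generalizing Y with
  | zero =>
    simp only [Function.iterate_zero, id]
    convert hasSum_ite_eq Y (if Y ∈ A then (1 : ℝ) else 0) using 2 with Z
    by_cases h : Y = Z
    · subst h; simp
    · simp [h, Ne.symm h]
  | succ n ih =>
    simp only [Function.iterate_succ_apply']
    have := hasSum_sum (f := fun i Z => p * ((if Z ∈ A then 1 else 0) *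
        (generator p)^[n] (fun W => if W = Z then 1 else 0) (tryJump Y i 1) -
        (if Z ∈ A then 1 else 0) * (generator p)^[n] (fun W => if W = Z then 1 else 0) Y) +
      (1 - p) * ((if Z ∈ A then 1 else 0) *
        (generator p)^[n] (fun W => if W = Z then 1 else 0) (tryJump Y i (-1)) -
        (if Z ∈ A then 1 else 0) * (generator p)^[n] (fun W => if W = Z then 1 else 0) Y))
      (s := (Finset.univ : Finset (Fin N))) fun i _ =>
      (((ih (tryJump Y i 1)).sub (ih Y)).mul_left p).add
        (((ih (tryJump Y i (-1))).sub (ih Y)).mul_left (1 - p))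
    refine this.congr_fun fun Z => ?_
    rw [generator, Finset.mul_sum]
    refine Finset.sum_congr rfl fun i _ => ?_
    ring

/-- Fubini's theorem for series: the double family is absolutely summable because `C n` bounds the
inner sums. -/
theorem hasSum_tsum_mul_tsum {ι : Type*} {C w : ℕ → ℝ} (hw : Summable fun n => |w n| * C n)
    {a : ℕ → ι → ℝ} (ha : ∀ n (S : Finset ι), ∑ z ∈ S, |a n z| ≤ C n)
    {c : ι → ℝ} (hc : ∀ z, |c z| ≤ 1)
    {b : ℕ → ℝ} (hb : ∀ n, HasSum (fun z => c z * a n z) (b n)) :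
    HasSum (fun n => w n * b n) (∑' z, c z * ∑' n, w n * a n z) := by
  have hs : ∀ n, Summable fun z => |a n z| := fun n =>
    summable_of_sum_le (fun _ => abs_nonneg _) fun S => ha n S
  have hle : ∀ n, ∑' z, |a n z| ≤ C n := fun n =>
    Real.tsum_le_of_sum_le (fun _ => abs_nonneg _) fun S => ha n S
  have hsum : Summable fun x : ℕ × ι => c x.2 * (w x.1 * a x.1 x.2) := by
    have : Summable fun x : ℕ × ι => |w x.1| * |a x.1 x.2| := by
      have h0 : ∀ x : ℕ × ι, 0 ≤ |w x.1| * |a x.1 x.2| := fun x =>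
        mul_nonneg (abs_nonneg _) (abs_nonneg _)
      have h1 : ∀ n, Summable fun z => |w n| * |a n z| := fun n => (hs n).mul_left |w n|
      rw [summable_prod_of_nonneg h0]
      refine ⟨h1, ?_⟩
      simp only [tsum_mul_left]
      refine Summable.of_nonneg_of_le (fun n => ?_) (fun n => ?_) hw
      · exact mul_nonneg (abs_nonneg _) (tsum_nonneg fun _ => abs_nonneg _)
      · exact mul_le_mul_of_nonneg_left (hle n) (abs_nonneg _)
    refine Summable.of_norm_bounded this fun x => ?_
    rw [norm_mul, norm_mul, Real.norm_eq_abs, Real.norm_eq_abs, Real.norm_eq_abs]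
    exact mul_le_of_le_one_left (by positivity) (hc _)
  have h1 := hsum.hasSum.prod_fiberwise fun n =>
    ((hb n).mul_left (w n)).congr_fun fun z => by ring
  have h2 := (hsum.prod_symm).tsum_prod
  rw [← (Equiv.prodComm ι ℕ).tsum_eq] at h1
  simp only [Prod.fst_swap, Prod.snd_swap, tsum_mul_left, Equiv.prodComm_apply] at h1 h2
  rwa [h2] at h1

theorem hasSum_transition {N : ℕ} {p : ℝ} (hp0 : 0 ≤ p) (hp1 : p ≤ 1) (t : ℝ)
    (A : Set (Config N)) [DecidablePred (· ∈ A)] (Y : Config N) :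
    HasSum (fun n : ℕ => t ^ n / (n ! : ℝ) *
        (generator p)^[n] (fun W => if W ∈ A then 1 else 0) Y)
      (∑' Z, (if Z ∈ A then 1 else 0) * transition p t Y Z) := by
  refine hasSum_tsum_mul_tsum (C := fun n => (2 * N : ℝ) ^ n) ?_
    (fun n S => sum_abs_generator_iterate_le hp0 hp1 S n Y)
    (fun Z => by split_ifs <;> simp) fun n => hasSum_generator_iterate A n Y
  refine (Real.summable_pow_div_factorial (|t| * (2 * N))).congr fun n => ?_
  rw [abs_div, abs_pow, Nat.abs_cast, mul_pow]
  ring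

theorem prob_mem {N : ℕ} {p : ℝ} {Y : Config N} {Ω : Type*} [MeasurableSpace Ω] {P : Measure Ω}
    [IsProbabilityMeasure P] {X : ℝ≥0 → Ω → Config N} (hX : IsASEP p Y P X) (t : ℝ≥0)
    (A : Set (Config N)) [DecidablePred (· ∈ A)] :
    P.real {ω | X t ω ∈ A} = ∑' Z, (if Z ∈ A then 1 else 0) * transition p t Y Z := by
  have hms : ∀ s Z, MeasurableSet (X s ⁻¹' {Z}) := fun s Z =>
    hX.measurable s (measurableSet_singleton Z)
  -- The marginal at time `0` shows that the process starts at `Y` almost surely; the joint law at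
  -- times `0` and `t` then gives the law at time `t`.
  have h0 := hX.fdd 0 (fun _ => 0) (fun _ => Y) (fun _ _ _ => le_rfl) rfl
  simp only [forall_const, if_true, Finset.univ_eq_empty, Finset.prod_empty, mul_one] at h0
  have hm : ∀ᵐ ω ∂P, X 0 ω = Y := by
    refine (mem_ae_iff_prob_eq_one (hms 0 Y)).2 ?_
    rw [measureReal_def, ENNReal.toReal_eq_one_iff] at h0
    exact h0
  have hZ : ∀ Z, P.real (X t ⁻¹' {Z}) = transition p t Y Z := by
    intro Z
    have h1 := hX.fdd 1 ![0, t] ![Y, Z] (by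
      rw [Fin.monotone_iff_le_succ]; intro i; fin_cases i; simp) rfl
    simp [Fin.forall_fin_two] at h1
    rw [← h1]
    refine measureReal_congr ?_
    filter_upwards [hm] with ω hω
    exact propext ⟨fun h => ⟨hω, h⟩, fun h => h.2⟩
  have hP : IsProbabilityMeasure (P.map (X t)) :=
    Measure.isProbabilityMeasure_map (hX.measurable t).aemeasurable
  have h2 : P.real {ω | X t ω ∈ A} = (P.map (X t)).real A := by
    rw [map_measureReal_apply (hX.measurable t) A.to_countable.measurableSet]
    rfl
  rw [h2, ← integral_indicator_one A.to_countable.measurableSet, integral_countable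
    ((integrable_const 1).indicator A.to_countable.measurableSet)]
  refine tsum_congr fun Z => ?_
  rw [map_measureReal_apply (hX.measurable t) (measurableSet_singleton Z), hZ, smul_eq_mul,
    mul_comm]
  simp [Set.indicator_apply]

end ASEP

namespace ASEP

open Finset

/-! ### A rational function identity and its Vandermonde form. -/

/-- The sum is the coefficient of degree `#T + 1` in the Lagrange interpolation of `Q` at the `#T +
2` nodes `a`, `b` and `T`, and `Q` has smaller degree. -/
theorem lagrange_sum_eq_zero (T : Finset ℂ) {a b : ℂ} (hab : a ≠ b) (ha : a ∉ T) (hb : b ∉ T)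
    (Q : Polynomial ℂ) (hQ : Q.natDegree ≤ #T) :
    Q.eval a / ((a - b) * ∏ j ∈ T, (a - j)) + (Q.eval b / ((b - a) * ∏ j ∈ T, (b - j)) +
      ∑ i ∈ T, Q.eval i / ((i - a) * ((i - b) * ∏ j ∈ T.erase i, (i - j)))) = 0 := by
  have hab' : a ∉ insert b T := by simp [hab, ha]
  have hcard : #(insert a (insert b T)) = #T + 2 := by
    rw [card_insert_of_notMem hab', card_insert_of_notMem hb]
  have hdeg : Q.degree < #(insert a (insert b T)) := by
    refine lt_of_le_of_lt (Polynomial.degree_le_of_natDegree_le hQ) ?_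
    rw [hcard]
    exact_mod_cast Nat.lt_add_of_pos_right two_pos
  have h := Lagrange.coeff_eq_sum (v := id) (s := insert a (insert b T))
    (Function.injective_id.injOn) hdeg
  rw [Polynomial.coeff_eq_zero_of_natDegree_lt (by rw [hcard]; omega), sum_insert hab',
    sum_insert hb] at h
  rw [h]
  simp only [id]
  congr 1
  · rw [erase_insert hab', prod_insert hb]
  congr 1
  · rw [erase_insert_of_ne hab, erase_insert hb, prod_insert ha]
  · refine sum_congr rfl fun i hi => ?_
    have hia : a ≠ i := by rintro rfl; exact ha hi
    have hib : b ≠ i := by rintro rfl; exact hb hi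
    rw [erase_insert_of_ne hia, erase_insert_of_ne hib, prod_insert, prod_insert]
    · exact fun h => hb (mem_of_mem_erase h)
    · simp [hab, ha]

theorem sum_prod_f_div_sub_of_finset {p : ℝ} (hp : p ≠ 0) (hp1 : p ≠ 1) (T : Finset ℂ) (h0 : 0 ∉ T)
    (hT : (p / (1 - p) : ℂ) ∉ T) :
    p * ∑ i ∈ T, (1 - i) * ∏ j ∈ T.erase i, f p i j * j / (j - i) =
      (p : ℂ) ^ #T * (1 - ∏ j ∈ T, j) := by
  have hp' : (p : ℂ) ≠ 0 := by exact_mod_cast hp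
  have hq : (1 - p : ℂ) ≠ 0 := by
    rw [sub_ne_zero]; exact_mod_cast hp1.symm
  -- The zeros of `f p z z` are `1` and `b`. Interpolation uses the nodes `0`, `b` and `T`, applied
  -- to `Q z = ∏ j * f p z j`, whose factors are affine in `z`. The nodes `0` and `b` produce the
  -- two terms on the right.
  set b : ℂ := p / (1 - p) with hb
  have hqb : (1 - p) * b = p := by rw [hb]; field_simp
  have hb0 : b ≠ 0 := div_ne_zero hp' hq
  set Q : Polynomial ℂ := ∏ j ∈ T, (Polynomial.C (j * p) + Polynomial.C (j * ((1 - p) * j - 1)) *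
    Polynomial.X) with hQ
  have hev : ∀ z, Q.eval z = ∏ j ∈ T, j * f p z j := by
    intro z
    rw [hQ, Polynomial.eval_prod]
    refine prod_congr rfl fun j _ => ?_
    simp [f]
    ring
  have hdeg : Q.natDegree ≤ #T := by
    refine (Polynomial.natDegree_prod_le _ _).trans ?_
    refine (sum_le_card_nsmul T _ 1 fun j _ => ?_).trans (by simp)
    compute_degree
  have key := lagrange_sum_eq_zero T hb0.symm h0 hT Q hdeg
  have hj0 : ∀ j ∈ T, j ≠ 0 := fun j hj h => h0 (h ▸ hj)
  have hjb : ∀ j ∈ T, b - j ≠ 0 := fun j hj h => hT (by rwa [sub_eq_zero.1 h])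
  have e1 : Q.eval 0 = (-1) ^ #T * (p : ℂ) ^ #T * ∏ j ∈ T, (0 - j) := by
    rw [hev, ← mul_pow, ← prod_const, ← prod_mul_distrib]
    exact prod_congr rfl fun j _ => by simp [f]; ring
  have e2 : Q.eval b = (-1) ^ #T * (p : ℂ) ^ #T * (∏ j ∈ T, j) * ∏ j ∈ T, (b - j) := by
    rw [hev, ← mul_pow, ← prod_const, ← prod_mul_distrib, ← prod_mul_distrib]
    refine prod_congr rfl fun j _ => ?_
    simp only [f]
    linear_combination (j * j - j) * hqb
  have hd1 : ∏ j ∈ T, (0 - j) ≠ 0 := prod_ne_zero_iff.2 fun j hj => by simpa using hj0 j hj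
  have hd2 : ∏ j ∈ T, (b - j) ≠ 0 := prod_ne_zero_iff.2 hjb
  have e3 : ∀ i ∈ T, Q.eval i / ((i - 0) * ((i - b) * ∏ j ∈ T.erase i, (i - j))) =
      (-1) ^ #T * (1 - p) * ((1 - i) * ∏ j ∈ T.erase i, f p i j * j / (j - i)) := by
    intro i hi
    have hi0 := hj0 i hi
    have hib : i - b ≠ 0 := by
      have := hjb i hi
      rw [sub_ne_zero] at this ⊢
      exact this.symm
    -- The factor `j = i` of `Q.eval i` cancels the denominators `i - 0` and `i - b`, leaving `1 -
    -- i`.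
    have hfi : f p i i = -(1 - p) * (1 - i) * (i - b) := by
      simp only [f]
      linear_combination (i - 1) * hqb
    have hc : #T = #(T.erase i) + 1 := by rw [card_erase_of_mem hi]; have := card_pos.2 ⟨i, hi⟩; omega
    have hprod : ∏ j ∈ T.erase i, f p i j * j / (j - i) =
        (-1) ^ #(T.erase i) * ((∏ j ∈ T.erase i, j * f p i j) / ∏ j ∈ T.erase i, (i - j)) := by
      rw [← prod_const, ← prod_div_distrib, ← prod_mul_distrib]
      refine prod_congr rfl fun j hj => ?_
      rw [← neg_sub i j, div_neg]
      ring
    have hne : ∏ j ∈ T.erase i, (i - j) ≠ 0 :=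
      prod_ne_zero_iff.2 fun j hj => sub_ne_zero.2 (mem_erase.1 hj).1.symm
    rw [hev, ← mul_prod_erase T _ hi, hfi, hprod, hc]
    have hs : ((-1 : ℂ) ^ #(T.erase i)) * (-1) ^ #(T.erase i) = 1 := by
      rw [← mul_pow]; simp
    field_simp
    rw [pow_succ, sub_zero]
    linear_combination i * (1 - i) * (∏ j ∈ T.erase i, j * f p i j) * hs
  rw [sum_congr rfl e3, ← mul_sum, e1, e2] at key
  rw [mul_div_mul_right _ _ hd1, mul_div_mul_right _ _ hd2] at key
  have hs : ((-1 : ℂ) ^ #T) * (-1) ^ #T = 1 := by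
    rw [← mul_pow]; simp
  set W := ∑ i ∈ T, (1 - i) * ∏ j ∈ T.erase i, f p i j * j / (j - i)
  have hdiv : ∀ z : ℂ, z / b = z * ((1 - p) / p) := fun z => by rw [hb]; field_simp
  have key2 : (-1) ^ #T * (1 - p) * (- p ^ #T / p * (1 - ∏ j ∈ T, j) + W) = 0 := by
    rw [← key, zero_sub, sub_zero, div_neg]
    rw [hdiv, hdiv]
    field_simp
    ring
  have key3 := (mul_eq_zero.1 key2).resolve_left (mul_ne_zero (pow_ne_zero _ (by simp)) hq)
  field_simp at key3
  linear_combination key3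

theorem sum_prod_f_div_sub {ι : Type*} [DecidableEq ι] {p : ℝ} (hp : p ≠ 0) (hp1 : p ≠ 1)
    (S : Finset ι) (ζ : ι → ℂ) (hζ : Function.Injective ζ) (h0 : ∀ i, ζ i ≠ 0)
    (hb : ∀ i, ζ i ≠ p / (1 - p)) :
    p * ∑ i ∈ S, (1 - ζ i) * ∏ j ∈ S.erase i, f p (ζ i) (ζ j) * ζ j / (ζ j - ζ i) =
      (p : ℂ) ^ #S * (1 - ∏ j ∈ S, ζ j) := by
  have := sum_prod_f_div_sub_of_finset hp hp1 (S.image ζ) (by simpa using fun i _ => h0 i)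
    (by simpa using fun i _ => hb i)
  rw [card_image_of_injective _ hζ, prod_image hζ.injOn, sum_image hζ.injOn] at this
  rw [← this]
  congr 1
  refine sum_congr rfl fun i _ => ?_
  rw [← image_erase hζ, prod_image hζ.injOn]

/-- The Vandermonde product of the variables with indices in `S`. -/
def vandermonde {N : ℕ} (S : Finset (Fin N)) (ζ : Fin N → ℂ) : ℂ :=
  ∏ i ∈ S, ∏ j ∈ S with i < j, (ζ j - ζ i)

theorem vandermonde_eq_prod_Iio {N : ℕ} (S : Finset (Fin N)) (ζ : Fin N → ℂ) :
    vandermonde S ζ = ∏ j, ∏ i ∈ Iio j, if i ∈ S ∧ j ∈ S then ζ j - ζ i else 1 := by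
  rw [vandermonde, prod_sigma', prod_sigma']
  rw [← prod_filter_mul_prod_filter_not (univ.sigma _) (fun x : (_ : Fin N) × Fin N =>
    (x.2 ∈ S ∧ x.1 ∈ S))]
  rw [prod_congr (s₂ := (univ.sigma _).filter fun x : (_ : Fin N) × Fin N =>
    ¬ (x.2 ∈ S ∧ x.1 ∈ S)) rfl (g := fun _ => 1) (fun x hx => by
      rw [if_neg (mem_filter.1 hx).2])]
  rw [prod_const_one, mul_one]
  refine prod_nbij' (fun x => ⟨x.2, x.1⟩) (fun x => ⟨x.2, x.1⟩) ?_ ?_ ?_ ?_ ?_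
  · rintro ⟨i, j⟩ h; simp at h ⊢; tauto
  · rintro ⟨i, j⟩ h; simp at h ⊢; tauto
  · simp
  · simp
  · rintro ⟨i, j⟩ h; simp at h ⊢; intro h'; exact absurd h.2.1 (h' h.1)

theorem vandermonde_comp_perm {N : ℕ} (k : ℕ) (ζ : Fin N → ℂ) (τ : Equiv.Perm (Fin N))
    (hτ : ∀ i : Fin N, (i : ℕ) < k → τ i = i) :
    vandermonde (univ.filter fun i : Fin N => k ≤ i) (ζ ∘ τ) =
      Equiv.Perm.sign τ * vandermonde (univ.filter fun i : Fin N => k ≤ i) ζ := by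
  have hge : ∀ i : Fin N, k ≤ i → k ≤ τ i := by
    intro i hi
    by_contra h
    have h1 := hτ _ (not_le.1 h)
    rw [τ.injective h1] at h
    exact h hi
  -- The difference is completed to an antisymmetric function of all pairs by `±1` off the tail.
  -- Those pairs keep their order, because `τ` fixes the indices below `k` and preserves the tail,
  -- so they contribute `1`.
  have key := τ.prod_Iio_comp_eq_sign_mul_prod (R := ℂ) (f := fun i j : Fin N =>
    if k ≤ (i : ℕ) ∧ k ≤ (j : ℕ) then ζ j - ζ i else if i < j then 1 else if j < i then -1 else 0) (by
      intro i j
      by_cases h : k ≤ (i : ℕ) ∧ k ≤ (j : ℕ)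
      · rw [if_pos h, if_pos h.symm]; ring
      · have h2 : ¬ (k ≤ (j : ℕ) ∧ k ≤ (i : ℕ)) := fun h' => h ⟨h'.2, h'.1⟩
        rw [if_neg h, if_neg h2]
        rcases lt_trichotomy i j with h1 | h1 | h1
        · simp [h1, h1.not_gt]
        · simp [h1]
        · simp [h1, h1.not_gt])
  have hv : ∀ ζ : Fin N → ℂ, vandermonde (univ.filter fun i : Fin N => k ≤ i) ζ =
      ∏ j : Fin N, ∏ i ∈ Iio j, if k ≤ (i : ℕ) ∧ k ≤ (j : ℕ) then ζ j - ζ i else 1 := by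
    intro ζ
    simp [vandermonde_eq_prod_Iio]
  rw [hv, hv]
  convert key using 1
  · refine prod_congr rfl fun j _ => prod_congr rfl fun i hi => ?_
    have hij := mem_Iio.1 hi
    by_cases h : k ≤ (i : ℕ) ∧ k ≤ (j : ℕ)
    · simp [h, hge]
    · have hi' : (i : ℕ) < k := by
        have : (i : ℕ) < j := hij
        by_contra h'
        exact h ⟨by omega, by omega⟩
      rw [if_neg h, hτ i hi', if_neg (by omega)]
      rw [if_pos]
      by_cases hj : k ≤ (j : ℕ)
      · exact Fin.lt_def.2 (lt_of_lt_of_le hi' (hge j hj))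
      · rw [hτ j (by omega)]; exact hij
  · congr 1
    refine prod_congr rfl fun j _ => prod_congr rfl fun i hi => ?_
    rw [if_pos (mem_Iio.1 hi)]

theorem vandermonde_eq_mul {N : ℕ} (k : Fin N) (ζ : Fin N → ℂ) :
    vandermonde (univ.filter fun i : Fin N => (k : ℕ) ≤ i) ζ =
      (∏ j ∈ Ioi k, (ζ j - ζ k)) * vandermonde (univ.filter fun i : Fin N => (k + 1 : ℕ) ≤ i) ζ := by
  have h : (univ.filter fun i : Fin N => (k : ℕ) ≤ i) =
      insert k (univ.filter fun i : Fin N => (k + 1 : ℕ) ≤ i) := by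
    ext i
    simp [Fin.ext_iff]
    omega
  rw [h, vandermonde, prod_insert (by simp)]
  congr 1
  · refine prod_congr ?_ fun _ _ => rfl
    ext j
    simp only [mem_filter, mem_insert, mem_univ, true_and, mem_Ioi, Fin.lt_def, Fin.ext_iff]
    omega
  · rw [vandermonde]
    refine prod_congr rfl fun i hi => prod_congr ?_ fun _ _ => rfl
    ext j
    simp only [mem_filter, mem_insert, mem_univ, true_and, Fin.lt_def, Fin.ext_iff] at hi ⊢
    omega

theorem continuous_vandermonde {N : ℕ} (S : Finset (Fin N)) : Continuous (vandermonde S) := by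
  unfold vandermonde
  fun_prop

/-- The partial fraction identity multiplied by the Vandermonde product of the tail: swapping `l`
into position `k` and splitting off that variable cancels the denominators `ζ j - ζ l`, up to the
sign of the swap. -/
theorem sum_swap_vandermonde_of_injective {N : ℕ} {p : ℝ} (hp : p ≠ 0) (hp1 : p ≠ 1) (k : Fin N)
    (ζ : Fin N → ℂ) (hζ : Function.Injective ζ) (h0 : ∀ i, ζ i ≠ 0)
    (hb : ∀ i, ζ i ≠ p / (1 - p)) :
    p * ∑ l ∈ univ.filter (fun i : Fin N => (k : ℕ) ≤ i), ((Equiv.swap k l).sign : ℂ) * ((1 - ζ l) *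
        (∏ j ∈ (univ.filter fun i : Fin N => (k : ℕ) ≤ i).erase l, f p (ζ l) (ζ j) * ζ j) *
        vandermonde (univ.filter fun i : Fin N => (k + 1 : ℕ) ≤ i) (ζ ∘ Equiv.swap k l)) =
      (p : ℂ) ^ (N - k) * (1 - ∏ j ∈ univ.filter (fun i : Fin N => (k : ℕ) ≤ i), ζ j) *
        vandermonde (univ.filter fun i : Fin N => (k : ℕ) ≤ i) ζ := by
  set S := univ.filter fun i : Fin N => (k : ℕ) ≤ i with hS
  have hcard : #S = N - k := by
    have : S = Ici k := by ext; simp [hS]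
    rw [this, Fin.card_Ici]
  rw [← hcard, ← sum_prod_f_div_sub hp hp1 S ζ hζ h0 hb, mul_assoc, sum_mul]
  congr 1
  refine sum_congr rfl fun l hl => ?_
  have hkl : (k : ℕ) ≤ l := by simpa [hS] using hl
  have h1 := vandermonde_comp_perm k ζ (Equiv.swap k l) (by
    intro i hi
    refine Equiv.swap_apply_of_ne_of_ne ?_ ?_ <;> rintro rfl <;> omega)
  have h2 := vandermonde_eq_mul k (ζ ∘ Equiv.swap k l)
  have h3 : ∏ j ∈ Ioi k, ((ζ ∘ Equiv.swap k l) j - (ζ ∘ Equiv.swap k l) k) =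
      ∏ j ∈ S.erase l, (ζ j - ζ l) := by
    refine prod_nbij' (Equiv.swap k l) (Equiv.swap k l) ?_ ?_ ?_ ?_ ?_
    · intro j hj
      have hj : k < j := mem_Ioi.1 hj
      rw [mem_erase]
      refine ⟨fun h => hj.ne' ?_, ?_⟩
      · rw [Equiv.swap_apply_eq_iff, Equiv.swap_apply_right] at h; exact h
      · rw [hS, mem_filter]
        refine ⟨mem_univ _, ?_⟩
        rw [Equiv.swap_apply_def]
        split_ifs <;> omega
    · intro j hj
      rw [mem_erase, hS, mem_filter] at hj
      rw [mem_Ioi, Equiv.swap_apply_def]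
      split_ifs with h h'
      · subst h
        exact lt_of_le_of_ne hkl hj.1
      · exact absurd h' hj.1
      · exact lt_of_le_of_ne hj.2.2 (Ne.symm h)
    · simp
    · simp
    · simp
  rw [← hS] at h1 h2
  have hs : ((Equiv.swap k l).sign : ℂ) * (Equiv.swap k l).sign = 1 := by
    rcases Int.units_eq_one_or (Equiv.swap k l).sign with h | h <;> simp [h]
  have hd : ∏ j ∈ S.erase l, (ζ j - ζ l) ≠ 0 :=
    prod_ne_zero_iff.2 fun j hj => sub_ne_zero.2 (hζ.ne (mem_erase.1 hj).1)
  rw [h1, h3] at h2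
  rw [prod_div_distrib]
  have h4 : vandermonde S ζ = ((Equiv.swap k l).sign : ℂ) * ((∏ j ∈ S.erase l, (ζ j - ζ l)) *
      vandermonde (univ.filter fun i : Fin N => (k + 1 : ℕ) ≤ i) (ζ ∘ Equiv.swap k l)) := by
    rw [← h2, ← mul_assoc, hs, one_mul]
  rw [h4]
  field_simp

theorem sum_swap_vandermonde {N : ℕ} (p : ℝ) (k : Fin N) (ζ : Fin N → ℂ) :
    p * ∑ l ∈ univ.filter (fun i : Fin N => (k : ℕ) ≤ i), ((Equiv.swap k l).sign : ℂ) * ((1 - ζ l) *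
        (∏ j ∈ (univ.filter fun i : Fin N => (k : ℕ) ≤ i).erase l, f p (ζ l) (ζ j) * ζ j) *
        vandermonde (univ.filter fun i : Fin N => (k + 1 : ℕ) ≤ i) (ζ ∘ Equiv.swap k l)) =
      (p : ℂ) ^ (N - k) * (1 - ∏ j ∈ univ.filter (fun i : Fin N => (k : ℕ) ≤ i), ζ j) *
        vandermonde (univ.filter fun i : Fin N => (k : ℕ) ≤ i) ζ := by
  have hne : ∀ p : ℝ, p ≠ 0 → p ≠ 1 → ∀ ζ : Fin N → ℂ,
    p * ∑ l ∈ univ.filter (fun i : Fin N => (k : ℕ) ≤ i), ((Equiv.swap k l).sign : ℂ) * ((1 - ζ l) *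
        (∏ j ∈ (univ.filter fun i : Fin N => (k : ℕ) ≤ i).erase l, f p (ζ l) (ζ j) * ζ j) *
        vandermonde (univ.filter fun i : Fin N => (k + 1 : ℕ) ≤ i) (ζ ∘ Equiv.swap k l)) =
      (p : ℂ) ^ (N - k) * (1 - ∏ j ∈ univ.filter (fun i : Fin N => (k : ℕ) ≤ i), ζ j) *
        vandermonde (univ.filter fun i : Fin N => (k : ℕ) ≤ i) ζ := by
    intro p hp hp1 ζ
    -- Both sides are continuous, so degenerate points are reached along a line. Its slopes `i + 1`
    -- are nonzero and distinct, hence only finitely many `t`, those in `B`, make coordinates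
    -- collide or hit `0` or `p / (1 - p)`.
    let η : ℂ → Fin N → ℂ := fun t i => ζ i + t * ((i : ℕ) + 1 : ℂ)
    have hηc : Continuous η := by fun_prop
    have hαi : ∀ i : Fin N, ((i : ℕ) + 1 : ℂ) ≠ 0 := fun i => Nat.cast_add_one_ne_zero _
    let B : Set ℂ := (Set.range fun i => -ζ i / ((i : ℕ) + 1 : ℂ)) ∪
      (Set.range fun i => (p / (1 - p) - ζ i) / ((i : ℕ) + 1 : ℂ)) ∪
      (Set.range fun x : Fin N × Fin N => (ζ x.1 - ζ x.2) / (((x.2 : ℕ) : ℂ) - (x.1 : ℕ)))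
    have hB : B.Finite := ((Set.finite_range _).union (Set.finite_range _)).union
      (Set.finite_range _)
    have hd : Dense Bᶜ := hB.countable.dense_compl ℂ
    have hfc : ∀ i j : Fin N, Continuous fun t => f p (η t i) (η t j) := by
      intro i j
      unfold f
      fun_prop
    have := Continuous.ext_on hd (f := fun t => p * ∑ l ∈ univ.filter (fun i : Fin N => (k : ℕ) ≤ i),
        ((Equiv.swap k l).sign : ℂ) * ((1 - η t l) *
        (∏ j ∈ (univ.filter fun i : Fin N => (k : ℕ) ≤ i).erase l, f p (η t l) (η t j) * η t j) *
        vandermonde (univ.filter fun i : Fin N => (k + 1 : ℕ) ≤ i) (η t ∘ Equiv.swap k l)))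
      (g := fun t => (p : ℂ) ^ (N - k) *
        (1 - ∏ j ∈ univ.filter (fun i : Fin N => (k : ℕ) ≤ i), η t j) *
        vandermonde (univ.filter fun i : Fin N => (k : ℕ) ≤ i) (η t)) ?_ ?_ ?_
    · have h0 : η 0 = ζ := by ext; simp [η]
      simpa [h0] using congrFun this 0
    · refine continuous_const.mul (continuous_finsetSum _ fun l _ => continuous_const.mul
        (((by fun_prop : Continuous fun t => 1 - η t l).mul (continuous_finsetProd _ fun j _ =>
          (hfc l j).mul (by fun_prop))).mul ((continuous_vandermonde _).comp (by fun_prop))))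
    · exact (by fun_prop : Continuous fun t => (p : ℂ) ^ (N - k) *
        (1 - ∏ j ∈ univ.filter (fun i : Fin N => (k : ℕ) ≤ i), η t j)).mul
        ((continuous_vandermonde _).comp hηc)
    · intro t ht
      simp only [B, Set.mem_compl_iff, Set.mem_union, not_or, Set.mem_range, not_exists] at ht
      refine sum_swap_vandermonde_of_injective hp hp1 k (η t) ?_ ?_ ?_
      · intro i j hij
        by_contra hne
        have h1 : (((j : ℕ) : ℂ) - (i : ℕ)) ≠ 0 := by
          rw [sub_ne_zero]
          exact fun h => hne (Fin.ext (by exact_mod_cast h.symm))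
        refine ht.2 (i, j) ?_
        simp only [η] at hij
        rw [div_eq_iff h1]
        linear_combination hij
      · intro i hi
        refine ht.1.1 i ?_
        simp only [η] at hi
        rw [div_eq_iff (hαi i)]
        linear_combination -hi
      · intro i hi
        refine ht.1.2 i ?_
        simp only [η] at hi
        rw [div_eq_iff (hαi i)]
        linear_combination -hi
  -- The values `p = 0` and `p = 1` follow by continuity in `p`.
  have hd : Dense ({0, 1}ᶜ : Set ℝ) := (Set.toFinite _).countable.dense_compl ℝ
  have := Continuous.ext_on hd (f := fun p : ℝ => (p : ℂ) *
      ∑ l ∈ univ.filter (fun i : Fin N => (k : ℕ) ≤ i), ((Equiv.swap k l).sign : ℂ) * ((1 - ζ l) *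
        (∏ j ∈ (univ.filter fun i : Fin N => (k : ℕ) ≤ i).erase l, f p (ζ l) (ζ j) * ζ j) *
        vandermonde (univ.filter fun i : Fin N => (k + 1 : ℕ) ≤ i) (ζ ∘ Equiv.swap k l)))
    (g := fun p : ℝ => (p : ℂ) ^ (N - k) *
        (1 - ∏ j ∈ univ.filter (fun i : Fin N => (k : ℕ) ≤ i), ζ j) *
        vandermonde (univ.filter fun i : Fin N => (k : ℕ) ≤ i) ζ)
    (by unfold f; fun_prop) (by fun_prop) (fun p hp => by
      simp only [Set.mem_compl_iff, Set.mem_insert_iff, Set.mem_singleton_iff, not_or] at hp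
      exact hne p hp.1 hp.2 ζ)
  exact congrFun this p

/-! ### Antisymmetrized Bethe functions and the recursion in the number of prescribed particles. -/

/-- The indices of the particles from the `k`-th on (counted from `0`). -/
def tail {N : ℕ} (k : ℕ) : Finset (Fin N) := univ.filter fun i : Fin N => k ≤ i

theorem mem_tail {N k : ℕ} {i : Fin N} : i ∈ tail k ↔ k ≤ i := by simp [tail]

/-- The antisymmetrization of a function of `N` complex variables. -/
noncomputable def asym {N : ℕ} (Φ : (Fin N → ℂ) → ℂ) (ξ : Fin N → ℂ) : ℂ :=
  ∑ σ : Equiv.Perm (Fin N), (Equiv.Perm.sign σ : ℂ) * Φ (ξ ∘ σ)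

theorem sign_mul_self {N : ℕ} (σ : Equiv.Perm (Fin N)) :
    (Equiv.Perm.sign σ : ℂ) * Equiv.Perm.sign σ = 1 := by
  rcases Int.units_eq_one_or (Equiv.Perm.sign σ) with h | h <;> simp [h]

theorem asym_comp_right {N : ℕ} (Φ : (Fin N → ℂ) → ℂ) (τ : Equiv.Perm (Fin N))
    (ξ : Fin N → ℂ) : asym (fun ζ => Φ (ζ ∘ τ)) ξ = Equiv.Perm.sign τ * asym Φ ξ := by
  rw [asym, asym, mul_sum]
  refine Fintype.sum_equiv (Equiv.mulRight τ) _ _ fun σ => ?_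
  simp only [Equiv.coe_mulRight, Equiv.Perm.sign_mul, Equiv.Perm.coe_mul, Function.comp_assoc]
  push_cast
  linear_combination (-(Equiv.Perm.sign σ : ℂ) * Φ (ξ ∘ σ ∘ τ)) * sign_mul_self τ

theorem asym_comp {N : ℕ} (Φ : (Fin N → ℂ) → ℂ) (τ : Equiv.Perm (Fin N)) (ξ : Fin N → ℂ) :
    asym Φ (ξ ∘ τ) = Equiv.Perm.sign τ * asym Φ ξ := by
  rw [asym, asym, mul_sum]
  refine Fintype.sum_equiv (Equiv.mulLeft τ) _ _ fun σ => ?_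
  simp only [Equiv.coe_mulLeft, Equiv.Perm.sign_mul, Equiv.Perm.coe_mul, Function.comp_assoc]
  push_cast
  linear_combination (-(Equiv.Perm.sign σ : ℂ) * Φ (ξ ∘ τ ∘ σ)) * sign_mul_self τ

theorem asym_eq_zero_of_symm {N : ℕ} {Φ : (Fin N → ℂ) → ℂ} {a b : Fin N} (hab : a ≠ b)
    {ξ : Fin N → ℂ} (h : ∀ σ : Equiv.Perm (Fin N),
      Φ ((ξ ∘ σ) ∘ Equiv.swap a b) = Φ (ξ ∘ σ)) : asym Φ ξ = 0 := by
  have h1 := asym_comp_right Φ (Equiv.swap a b) ξ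
  have h2 : asym (fun ζ => Φ (ζ ∘ Equiv.swap a b)) ξ = asym Φ ξ := by
    unfold asym
    exact sum_congr rfl fun σ _ => congrArg _ (h σ)
  rw [h2, Equiv.Perm.sign_swap hab] at h1
  push_cast at h1
  linear_combination h1 / 2

/-- The summand for the identity permutation of the contour integral formula: the positions of the
particles `0, …, k - 1` are fixed, and those of the others are summed over. -/
noncomputable def bethe (p : ℝ) {N : ℕ} (k : ℕ) (x : Fin N → ℤ) (ξ : Fin N → ℂ) : ℂ :=
  (∏ i ∈ (tail k)ᶜ, ∏ j ∈ Ioi i, f p (ξ i) (ξ j)) *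
    ((p : ℂ) ^ ((N - k) * (N - k - 1) / 2) * vandermonde (tail k) ξ / ∏ j ∈ tail k, (1 - ξ j)) *
    ∏ i, ξ i ^ x i

section swap

variable {N : ℕ} {k l : Fin N}

theorem swap_apply_of_lt (hl : l ∈ tail (N := N) k) {i : Fin N} (hi : i < k) :
    Equiv.swap k l i = i := by
  have := mem_tail.1 hl
  refine Equiv.swap_apply_of_ne_of_ne ?_ ?_ <;> rintro rfl
  · exact lt_irrefl _ hi
  · exact absurd (Fin.lt_def.1 hi) (not_lt.2 this)

theorem swap_mem_tail (hl : l ∈ tail (N := N) k) {i : Fin N} :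
    Equiv.swap k l i ∈ tail (N := N) k ↔ i ∈ tail (N := N) k := by
  have := mem_tail.1 hl
  rw [mem_tail, mem_tail, Equiv.swap_apply_def]
  split_ifs with h h'
  · subst h; simp [this]
  · subst h'; simp [this]
  · rfl

theorem prod_tail_succ_swap (hl : l ∈ tail (N := N) k) (g : Fin N → ℂ) :
    ∏ j ∈ tail (N := N) (k + 1), g (Equiv.swap k l j) = ∏ j ∈ (tail (N := N) k).erase l, g j := by
  have hkl := mem_tail.1 hl
  refine prod_nbij' (Equiv.swap k l) (Equiv.swap k l) ?_ ?_ ?_ ?_ ?_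
  · intro j hj
    have hj := mem_tail.1 hj
    rw [mem_erase, swap_mem_tail hl, mem_tail]
    refine ⟨fun h => ?_, by omega⟩
    rw [Equiv.swap_apply_eq_iff, Equiv.swap_apply_right] at h
    subst h
    omega
  · intro j hj
    rw [mem_erase, mem_tail] at hj
    rw [mem_tail, Equiv.swap_apply_def]
    split_ifs with h h'
    · subst h
      have : (j : ℕ) ≠ l := fun h => hj.1 (Fin.ext h)
      omega
    · exact absurd h' hj.1
    · have : (j : ℕ) ≠ k := fun h' => h (Fin.ext h')
      omega
  · simp
  · simp
  · simp

theorem Ioi_eq_tail (k : Fin N) : Ioi k = tail (N := N) (k + 1) := by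
  ext j
  rw [mem_Ioi, mem_tail, Fin.lt_def]
  omega

theorem compl_tail_succ (k : Fin N) :
    (tail (N := N) (k + 1))ᶜ = insert k (tail (N := N) k)ᶜ := by
  ext j
  simp only [mem_compl, mem_insert, mem_tail, Fin.ext_iff]
  omega

theorem prod_pairs_swap (p : ℝ) (hl : l ∈ tail (N := N) k) (ζ : Fin N → ℂ) :
    ∏ i ∈ (tail (N := N) (k + 1))ᶜ, ∏ j ∈ Ioi i,
        f p ((ζ ∘ Equiv.swap k l) i) ((ζ ∘ Equiv.swap k l) j) =
      (∏ i ∈ (tail (N := N) k)ᶜ, ∏ j ∈ Ioi i, f p (ζ i) (ζ j)) *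
        ∏ j ∈ (tail (N := N) k).erase l, f p (ζ l) (ζ j) := by
  rw [compl_tail_succ, prod_insert (by simp [mem_tail]), mul_comm]
  congr 1
  · refine prod_congr rfl fun i hi => ?_
    have hik : i < k := by
      rw [mem_compl, mem_tail, not_le] at hi
      exact hi
    have hle : k ≤ l := mem_tail.1 hl
    simp only [Function.comp_apply, swap_apply_of_lt hl hik]
    refine prod_nbij' (Equiv.swap k l) (Equiv.swap k l) ?_ ?_ (by simp) (by simp) (by simp) <;>
    · intro j hj
      rw [mem_Ioi] at hj ⊢
      rw [Equiv.swap_apply_def]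
      split_ifs
      · exact hik.trans_le hle
      · exact hik
      · exact hj
  · rw [Ioi_eq_tail, ← prod_tail_succ_swap hl]
    simp

theorem prod_zpow_swap {x x' : Fin N → ℤ} (hx : ∀ i ∈ tail (N := N) k, x i = x k)
    (hx' : ∀ i, x' i = if k < i then x i + 1 else x i)
    (hl : l ∈ tail (N := N) k) {ζ : Fin N → ℂ} (hζ : ∀ i, ζ i ≠ 0) :
    ∏ i, (ζ ∘ Equiv.swap k l) i ^ x' i =
      (∏ i, ζ i ^ x i) * ∏ j ∈ (tail (N := N) k).erase l, ζ j := by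
  have h1 : ∀ i, (ζ ∘ Equiv.swap k l) i ^ x' i =
      ζ (Equiv.swap k l i) ^ x (Equiv.swap k l i) *
        if i ∈ tail (N := N) (k + 1) then ζ (Equiv.swap k l i) else 1 := by
    intro i
    have hxi : x (Equiv.swap k l i) = x i := by
      by_cases hi : i ∈ tail (N := N) k
      · rw [hx i hi, hx _ ((swap_mem_tail hl).2 hi)]
      · rw [swap_apply_of_lt hl (by rw [mem_tail, not_le] at hi; exact hi)]
    rw [hxi, hx', Function.comp_apply]
    have hlt : k < i ↔ i ∈ tail (N := N) (k + 1) := by rw [mem_tail]; exact Fin.lt_def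
    by_cases h : k < i
    · rw [if_pos h, if_pos (hlt.1 h), zpow_add_one₀ (hζ _)]
    · rw [if_neg h, if_neg (fun h' => h (hlt.2 h')), mul_one]
  rw [prod_congr rfl fun i _ => h1 i, prod_mul_distrib,
    Equiv.prod_comp (Equiv.swap k l) fun i => ζ i ^ x i, prod_ite_mem, univ_inter,
    prod_tail_succ_swap hl fun j => ζ j]

theorem choose_two_sub (k : Fin N) :
    (N - k) * (N - k - 1) / 2 = (N - (k + 1)) * (N - (k + 1) - 1) / 2 + (N - (k + 1)) := by
  obtain ⟨m, hm⟩ : ∃ m, N - k = m + 1 := ⟨N - k - 1, by have := k.isLt; omega⟩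
  have h2 : N - (k + 1) = m := by omega
  rw [hm, h2, ← Nat.triangle_succ]

/-- This is `sum_swap_vandermonde` in terms of `bethe`: each summand selects the variable `ζ l` that
becomes the one of the newly prescribed particle `k`. As `x` is constant on the tail, the swap only
affects the extra powers in `x'`. -/
theorem bethe_mul_one_sub {p : ℝ} (hp : p ≠ 0) {x x' : Fin N → ℤ}
    (hx : ∀ i ∈ tail (N := N) k, x i = x k)
    (hx' : ∀ i, x' i = if k < i then x i + 1 else x i) {ζ : Fin N → ℂ} (h0 : ∀ i, ζ i ≠ 0)
    (h1 : ∀ i, ζ i ≠ 1) :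
    bethe p k x ζ * (1 - ∏ j ∈ tail (N := N) k, ζ j) =
      ∑ l ∈ tail (N := N) k, ((Equiv.swap k l).sign : ℂ) *
        bethe p (k + 1) x' (ζ ∘ Equiv.swap k l) := by
  have hp' : (p : ℂ) ≠ 0 := by exact_mod_cast hp
  have h1' : ∀ i, 1 - ζ i ≠ 0 := fun i => sub_ne_zero.2 (h1 i).symm
  have key := sum_swap_vandermonde p k ζ
  change p * ∑ l ∈ tail (N := N) k, ((Equiv.swap k l).sign : ℂ) * ((1 - ζ l) *
    (∏ j ∈ (tail (N := N) k).erase l, f p (ζ l) (ζ j) * ζ j) *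
      vandermonde (tail (k + 1)) (ζ ∘ Equiv.swap k l)) =
    p ^ (N - k) * (1 - ∏ j ∈ tail (N := N) k, ζ j) * vandermonde (tail k) ζ at key
  have hN : N - k = (N - (k + 1)) + 1 := by have := k.isLt; omega
  rw [hN, pow_succ'] at key
  rw [mul_assoc (p : ℂ), mul_assoc (p : ℂ)] at key
  have key := mul_left_cancel₀ hp' key
  set F := ∏ i ∈ (tail (N := N) k)ᶜ, ∏ j ∈ Ioi i, f p (ζ i) (ζ j) with hF
  set E := ∏ i, ζ i ^ x i with hE
  set M := (N - (k + 1)) * (N - (k + 1) - 1) / 2 with hM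
  have hterm : ∀ l ∈ tail (N := N) k, ((Equiv.swap k l).sign : ℂ) *
      bethe p (k + 1) x' (ζ ∘ Equiv.swap k l) =
      F * E * p ^ M / (∏ j ∈ tail (N := N) k, (1 - ζ j)) * (((Equiv.swap k l).sign : ℂ) *
        ((1 - ζ l) * (∏ j ∈ (tail (N := N) k).erase l, f p (ζ l) (ζ j) * ζ j) *
          vandermonde (tail (k + 1)) (ζ ∘ Equiv.swap k l))) := by
    intro l hl
    have hd : ∏ j ∈ (tail (N := N) k).erase l, (1 - ζ j) ≠ 0 := prod_ne_zero_iff.2 fun j _ => h1' j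
    have := h1' l
    rw [bethe, prod_pairs_swap p hl, prod_zpow_swap hx hx' hl h0, prod_mul_distrib,
      ← mul_prod_erase _ (fun j => 1 - ζ j) hl]
    have e := prod_tail_succ_swap hl fun j => 1 - ζ j
    simp only [Function.comp_apply]
    rw [e]
    field_simp
    rw [hF, hE, hM]
    ring
  rw [sum_congr rfl hterm, ← mul_sum, key, bethe, choose_two_sub, ← hM, pow_add]
  ring

end swap

theorem bethe_add_indicator {N : ℕ} (p : ℝ) (k : ℕ) {x x' : Fin N → ℤ}
    (hx' : ∀ i : Fin N, x' i = if k ≤ i then x i + 1 else x i) {ζ : Fin N → ℂ}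
    (h0 : ∀ i, ζ i ≠ 0) : bethe p k x' ζ = bethe p k x ζ * ∏ j ∈ tail (N := N) k, ζ j := by
  have : ∏ i, ζ i ^ x' i = (∏ i, ζ i ^ x i) * ∏ j ∈ tail (N := N) k, ζ j := by
    rw [← univ_inter (tail k), ← prod_ite_mem, ← prod_mul_distrib]
    refine prod_congr rfl fun i _ => ?_
    rw [hx']
    by_cases h : k ≤ (i : ℕ)
    · rw [if_pos h, if_pos (mem_tail.2 h), zpow_add_one₀ (h0 i)]
    · rw [if_neg h, if_neg fun h' => h (mem_tail.1 h'), mul_one]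
  rw [bethe, this, bethe]
  ring

/-- Shifting the tail positions by one multiplies `bethe` by the product of the tail variables, so
the difference carries the factor `1 - ∏ ζ j`. After expansion, antisymmetrization absorbs each swap
together with its sign, which leaves `N - k` equal terms. -/
theorem asym_bethe_sub {N : ℕ} {p : ℝ} (hp : p ≠ 0) {k : Fin N} {x x' x'' : Fin N → ℤ}
    (hx : ∀ i ∈ tail (N := N) k, x i = x k)
    (hx' : ∀ i, x' i = if k < i then x i + 1 else x i)
    (hx'' : ∀ i : Fin N, x'' i = if k ≤ i then x i + 1 else x i) {ξ : Fin N → ℂ}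
    (h0 : ∀ i, ξ i ≠ 0) (h1 : ∀ i, ξ i ≠ 1) :
    asym (bethe p k x) ξ - asym (bethe p k x'') ξ =
      (N - k : ℕ) * asym (bethe p (k + 1) x') ξ := by
  have e : asym (bethe p k x) ξ - asym (bethe p k x'') ξ =
      asym (fun ζ => ∑ l ∈ tail (N := N) k, ((Equiv.swap k l).sign : ℂ) *
        bethe p (k + 1) x' (ζ ∘ Equiv.swap k l)) ξ := by
    rw [asym, asym, asym, ← sum_sub_distrib]
    refine sum_congr rfl fun σ _ => ?_
    rw [← bethe_mul_one_sub (ζ := ξ ∘ σ) hp hx hx' (fun i => h0 (σ i)) fun i => h1 (σ i),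
      bethe_add_indicator (ζ := ξ ∘ σ) p k hx'' fun i => h0 (σ i)]
    ring
  have hcard : #(tail (N := N) k) = N - k := by
    have : tail (N := N) k = Ici k := by ext; simp [mem_tail]
    rw [this, Fin.card_Ici]
  rw [e, ← hcard, ← nsmul_eq_mul, ← sum_const]
  simp only [asym, mul_sum]
  rw [sum_comm]
  refine sum_congr rfl fun l _ => ?_
  have := asym_comp_right (bethe p (k + 1) x') (Equiv.swap k l) ξ
  simp only [asym, mul_sum] at this
  have hs := sign_mul_self (Equiv.swap k l)
  calc _ = ((Equiv.swap k l).sign : ℂ) * ∑ σ : Equiv.Perm (Fin N), (Equiv.Perm.sign σ : ℂ) *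
        bethe p (k + 1) x' ((ξ ∘ σ) ∘ Equiv.swap k l) := by
        rw [mul_sum]
        exact sum_congr rfl fun σ _ => by ring
    _ = _ := by
        rw [this, mul_sum]
        refine sum_congr rfl fun σ _ => ?_
        rw [← mul_assoc, hs, one_mul]

/-! ### The integral transform: boundary conditions and eigenvalue relations. -/

/-- The product of `f` over all pairs of variables. -/
noncomputable def pairProd (p : ℝ) {N : ℕ} (ξ : Fin N → ℂ) : ℂ :=
  ∏ i, ∏ j ∈ Ioi i, f p (ξ i) (ξ j)

theorem pairProd_eq_prod_filter (p : ℝ) {N : ℕ} (ξ : Fin N → ℂ) :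
    pairProd p ξ = ∏ x : Fin N × Fin N with x.1 < x.2, f p (ξ x.1) (ξ x.2) := by
  rw [pairProd, prod_filter, ← univ_product_univ, prod_product]
  refine prod_congr rfl fun i _ => ?_
  rw [← prod_filter]
  refine prod_congr ?_ fun _ _ => rfl
  ext j
  simp

/-- Swapping neighbouring indices reverses the order of no other pair. -/
theorem pairProd_swap (p : ℝ) {N : ℕ} {c s : Fin N} (hcs : (c : ℕ) + 1 = s) (ξ : Fin N → ℂ) :
    pairProd p (ξ ∘ Equiv.swap c s) * f p (ξ c) (ξ s) = pairProd p ξ * f p (ξ s) (ξ c) := by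
  have hmem : (c, s) ∈ univ.filter fun x : Fin N × Fin N => x.1 < x.2 := by
    rw [mem_filter]
    exact ⟨mem_univ _, Fin.lt_def.2 (by simp only; omega)⟩
  rw [pairProd_eq_prod_filter, pairProd_eq_prod_filter, ← mul_prod_erase _ _ hmem,
    ← mul_prod_erase _ (fun x : Fin N × Fin N => f p (ξ x.1) (ξ x.2)) hmem]
  have h : ∏ x ∈ (univ.filter fun x : Fin N × Fin N => x.1 < x.2).erase (c, s),
      f p ((ξ ∘ Equiv.swap c s) x.1) ((ξ ∘ Equiv.swap c s) x.2) =
      ∏ x ∈ (univ.filter fun x : Fin N × Fin N => x.1 < x.2).erase (c, s),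
        f p (ξ x.1) (ξ x.2) := by
    refine prod_nbij' (fun x => (Equiv.swap c s x.1, Equiv.swap c s x.2))
      (fun x => (Equiv.swap c s x.1, Equiv.swap c s x.2)) ?_ ?_ (by simp) (by simp) (by simp) <;>
    · rintro ⟨i, j⟩ hx
      simp only [mem_erase, mem_filter, mem_univ, true_and, Fin.lt_def, ne_eq, Prod.mk.injEq,
        Fin.ext_iff] at hx ⊢
      simp only [Equiv.swap_apply_def, Fin.ext_iff]
      split_ifs <;> omega
  rw [h]
  simp only [Function.comp_apply, Equiv.swap_apply_left, Equiv.swap_apply_right]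
  ring

theorem prod_zpow_swap_of_eq {N : ℕ} {c s : Fin N} {m : Fin N → ℤ} (hm : m c = m s)
    (ξ : Fin N → ℂ) : ∏ i, (ξ ∘ Equiv.swap c s) i ^ m i = ∏ i, ξ i ^ m i := by
  rw [← Equiv.prod_comp (Equiv.swap c s) fun i => ξ i ^ m i]
  refine prod_congr rfl fun i _ => ?_
  have : m (Equiv.swap c s i) = m i := by
    rw [Equiv.swap_apply_def]
    split_ifs with h h'
    · rw [h, hm]
    · rw [h', hm]
    · rfl
  rw [this, Function.comp_apply]

theorem prod_zpow_add_single {N : ℕ} (m : Fin N → ℤ) (i : Fin N) (d : ℤ) {ξ : Fin N → ℂ}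
    (h0 : ∀ i, ξ i ≠ 0) : ∏ j, ξ j ^ (m + Pi.single i d : Fin N → ℤ) j = (∏ j, ξ j ^ m j) * ξ i ^ d := by
  have : ∀ j, ξ j ^ (m + Pi.single i d : Fin N → ℤ) j = ξ j ^ m j * if j = i then ξ j ^ d else 1 := by
    intro j
    by_cases h : j = i
    · subst h
      simp [zpow_add₀ (h0 j)]
    · simp [h]
  rw [prod_congr rfl fun j _ => this j, prod_mul_distrib]
  simp

/-- The contour integral of `G` against the factors that depend on the initial configuration. -/
noncomputable def transform (p r : ℝ) {N : ℕ} (G : (Fin N → ℂ) → ℂ) (y : Fin N → ℤ) : ℂ :=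
  contour r fun ξ => G ξ / pairProd p ξ * ∏ i, ξ i ^ (-y i - 1)

/-- `r` is small enough that `f` has no zeros in the closed polydisc of radius `r`. -/
structure SmallRadius (p r : ℝ) : Prop where
  pos : 0 < r
  lt_one : r < 1
  f_ne_zero : ∀ ξ ξ' : ℂ, ‖ξ‖ ≤ r → ‖ξ'‖ ≤ r → f p ξ ξ' ≠ 0

section transform

variable {p r : ℝ} {N : ℕ}

theorem SmallRadius.ne_zero (hr : SmallRadius p r) {ξ : Fin N → ℂ} (h : ξ ∈ torus N r)
    (i : Fin N) : ξ i ≠ 0 := torus_ne_zero hr.pos h i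

theorem SmallRadius.ne_one (hr : SmallRadius p r) {ξ : Fin N → ℂ} (h : ξ ∈ torus N r)
    (i : Fin N) : ξ i ≠ 1 := fun h1 => by
  have := h i
  rw [h1, norm_one] at this
  exact hr.lt_one.ne this.symm

theorem SmallRadius.pairProd_ne_zero (hr : SmallRadius p r) {ξ : Fin N → ℂ}
    (h : ∀ i, ‖ξ i‖ ≤ r) : pairProd p ξ ≠ 0 :=
  prod_ne_zero_iff.2 fun i _ => prod_ne_zero_iff.2 fun j _ => hr.f_ne_zero _ _ (h i) (h j)

theorem continuous_pairProd (p : ℝ) : Continuous (pairProd p (N := N)) := by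
  unfold pairProd f
  fun_prop

theorem SmallRadius.continuousOn_prod_zpow (hr : SmallRadius p r) (m : Fin N → ℤ) :
    ContinuousOn (fun ξ : Fin N → ℂ => ∏ i, ξ i ^ m i) (torus N r) :=
  continuousOn_finsetProd _ fun i _ => ContinuousOn.zpow₀ (by fun_prop) _ fun _ h =>
    Or.inl (hr.ne_zero h i)

theorem SmallRadius.continuousOn_kernel (hr : SmallRadius p r) {G : (Fin N → ℂ) → ℂ}
    (hG : ContinuousOn G (torus N r)) (y : Fin N → ℤ) :
    ContinuousOn (fun ξ => G ξ / pairProd p ξ * ∏ i, ξ i ^ (-y i - 1)) (torus N r) :=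
  (hG.div (continuous_pairProd p).continuousOn fun _ h =>
    hr.pairProd_ne_zero fun i => (h i).le).mul (hr.continuousOn_prod_zpow fun i => -y i - 1)

theorem transform_congr (hr : SmallRadius p r) {G H : (Fin N → ℂ) → ℂ}
    (h : Set.EqOn G H (torus N r)) (y : Fin N → ℤ) : transform p r G y = transform p r H y :=
  contour_congr hr.pos.le fun ξ hξ => by simp only [h hξ]

theorem transform_const_mul (a : ℂ) (G : (Fin N → ℂ) → ℂ) (y : Fin N → ℤ) :
    transform p r (fun ξ => a * G ξ) y = a * transform p r G y := by
  rw [transform, transform, ← contour_const_mul]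
  congr 1
  ext ξ
  ring

theorem transform_sum (hr : SmallRadius p r) {ι : Type*} (s : Finset ι)
    {G : ι → (Fin N → ℂ) → ℂ} (hG : ∀ i ∈ s, ContinuousOn (G i) (torus N r)) (y : Fin N → ℤ) :
    transform p r (fun ξ => ∑ i ∈ s, G i ξ) y = ∑ i ∈ s, transform p r (G i) y := by
  unfold transform
  rw [← contour_sum hr.pos.le s fun i hi => hr.continuousOn_kernel (hG i hi) y]
  simp only [sum_div, sum_mul]

theorem transform_add (hr : SmallRadius p r) {G H : (Fin N → ℂ) → ℂ}
    (hG : ContinuousOn G (torus N r)) (hH : ContinuousOn H (torus N r)) (y : Fin N → ℤ) :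
    transform p r (fun ξ => G ξ + H ξ) y = transform p r G y + transform p r H y := by
  unfold transform
  rw [← contour_add hr.pos.le (hr.continuousOn_kernel hG y) (hr.continuousOn_kernel hH y)]
  simp only [add_div, add_mul]

theorem transform_sub (hr : SmallRadius p r) {G H : (Fin N → ℂ) → ℂ}
    (hG : ContinuousOn G (torus N r)) (hH : ContinuousOn H (torus N r)) (y : Fin N → ℤ) :
    transform p r (fun ξ => G ξ - H ξ) y = transform p r G y - transform p r H y := by
  have := transform_add hr (H := fun ξ => -1 * H ξ) hG (continuousOn_const.mul hH) y
  rw [transform_const_mul] at this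
  simpa [sub_eq_add_neg] using this

theorem transform_add_single (hr : SmallRadius p r) (G : (Fin N → ℂ) → ℂ) (y : Fin N → ℤ)
    (i : Fin N) : transform p r G (y + Pi.single i 1) =
      transform p r (fun ξ => (ξ i)⁻¹ * G ξ) y := by
  refine contour_congr hr.pos.le fun ξ hξ => ?_
  have := prod_zpow_add_single (fun i => -y i - 1) i (-1) fun i => hr.ne_zero hξ i
  have e : (fun j => -(y + Pi.single i 1 : Fin N → ℤ) j - 1) = (fun i => -y i - 1) + Pi.single i (-1) := by
    ext j
    by_cases h : j = i
    · subst h; simp; ring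
    · simp [h]
  have e' : ∏ j, ξ j ^ (-(y + Pi.single i 1 : Fin N → ℤ) j - 1) =
    ∏ j, ξ j ^ ((fun i => -y i - 1) + Pi.single i (-1) : Fin N → ℤ) j := by rw [← e]
  simp only
  rw [e', this, zpow_neg_one]
  ring

theorem transform_sub_single (hr : SmallRadius p r) (G : (Fin N → ℂ) → ℂ) (y : Fin N → ℤ)
    (i : Fin N) : transform p r G (y - Pi.single i 1) =
      transform p r (fun ξ => ξ i * G ξ) y := by
  refine contour_congr hr.pos.le fun ξ hξ => ?_
  have := prod_zpow_add_single (fun i => -y i - 1) i 1 fun i => hr.ne_zero hξ i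
  have e : (fun j => -(y - Pi.single i 1 : Fin N → ℤ) j - 1) = (fun i => -y i - 1) + Pi.single i 1 := by
    ext j
    by_cases h : j = i
    · subst h; simp
    · simp [h]
  have e' : ∏ j, ξ j ^ (-(y - Pi.single i 1 : Fin N → ℤ) j - 1) =
    ∏ j, ξ j ^ ((fun i => -y i - 1) + Pi.single i 1 : Fin N → ℤ) j := by rw [← e]
  simp only
  rw [e', this, zpow_one]
  ring

theorem SmallRadius.continuousOn_inv (hr : SmallRadius p r) (i : Fin N) :
    ContinuousOn (fun ξ : Fin N → ℂ => (ξ i)⁻¹) (torus N r) :=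
  ContinuousOn.inv₀ (by fun_prop) fun _ h => hr.ne_zero h i

/-- The boundary condition in the initial configuration. -/
theorem transform_boundary (hr : SmallRadius p r) {G : (Fin N → ℂ) → ℂ}
    (hG : ContinuousOn G (torus N r)) {c s : Fin N} (hcs : (c : ℕ) + 1 = s)
    (hanti : ∀ ξ ∈ torus N r, G (ξ ∘ Equiv.swap c s) = -G ξ) {y : Fin N → ℤ}
    (hy : y s = y c + 1) :
    p * transform p r G (y + Pi.single c 1) + (1 - p) * transform p r G (y - Pi.single s 1) =
      transform p r G y := by
  rw [transform_add_single hr, transform_sub_single hr, ← sub_eq_zero]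
  have hc1 : ContinuousOn (fun ξ => p * ((ξ c)⁻¹ * G ξ)) (torus N r) :=
    continuousOn_const.mul ((hr.continuousOn_inv c).mul hG)
  have hc2 : ContinuousOn (fun ξ => (1 - p) * (ξ s * G ξ)) (torus N r) :=
    continuousOn_const.mul (ContinuousOn.mul (by fun_prop) hG)
  rw [← transform_const_mul, ← transform_const_mul,
    ← transform_add hr hc1 hc2, ← transform_sub hr (hc1.fun_add hc2) hG]
  unfold transform
  set W : (Fin N → ℂ) → ℂ := fun ξ =>
    (p * ((ξ c)⁻¹ * G ξ) + (1 - p) * (ξ s * G ξ) - G ξ) / pairProd p ξ * ∏ i, ξ i ^ (-y i - 1)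
    with hW
  -- Here `p / ξ_c + (1 - p) ξ_s - 1 = f p ξ_c ξ_s / ξ_c`. This cancels the only factor of
  -- `pairProd` that is not symmetric under the swap, and `y s = y c + 1` makes the exponents of
  -- `ξ_c` and `ξ_s` equal. So `W` is antisymmetric under the swap and its integral vanishes.
  have hW' : ∀ ξ ∈ torus N r, W ξ = G ξ * (f p (ξ c) (ξ s) / pairProd p ξ) *
      ∏ i, ξ i ^ ((fun i => -y i - 1) + Pi.single c (-1) : Fin N → ℤ) i := by
    intro ξ hξ
    rw [prod_zpow_add_single (fun i => -y i - 1) c (-1) fun i => hr.ne_zero hξ i]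
    have := hr.ne_zero hξ c
    simp only [hW, f, zpow_neg_one]
    field_simp
  have hsym : ∀ ξ ∈ torus N r, W (ξ ∘ Equiv.swap c s) = -W ξ := by
    intro ξ hξ
    rw [hW' ξ hξ, hW' _ (torus_comp hξ _), hanti ξ hξ, prod_zpow_swap_of_eq]
    · have h1 : pairProd p ξ ≠ 0 := hr.pairProd_ne_zero fun i => (hξ i).le
      have h2 : pairProd p (ξ ∘ Equiv.swap c s) ≠ 0 :=
        hr.pairProd_ne_zero fun i => (hξ _).le
      have : f p (ξ s) (ξ c) / pairProd p (ξ ∘ Equiv.swap c s) =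
          f p (ξ c) (ξ s) / pairProd p ξ := by
        rw [div_eq_div_iff h2 h1]
        linear_combination -pairProd_swap p hcs ξ
      simp only [Function.comp_apply, Equiv.swap_apply_left, Equiv.swap_apply_right]
      rw [this]
      ring
    · have : s ≠ c := by rintro rfl; omega
      simp [this, hy]
      ring
  have h1 := contour_comp_perm r (Equiv.swap c s) W
  rw [contour_congr hr.pos.le (h := fun ξ => -W ξ) hsym, contour_neg] at h1
  linear_combination -h1 / 2

/-- The eigenvalue relation for the free generator in the initial configuration. -/
theorem sum_free_transform (hr : SmallRadius p r) {G : (Fin N → ℂ) → ℂ}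
    (hG : ContinuousOn G (torus N r)) (y : Fin N → ℤ) :
    ∑ i, (p * transform p r G (y + Pi.single i 1) +
        (1 - p) * transform p r G (y - Pi.single i 1) - transform p r G y) =
      transform p r (fun ξ => (∑ i, ε p (ξ i)) * G ξ) y := by
  have hc1 : ∀ i : Fin N, ContinuousOn (fun ξ => p * ((ξ i)⁻¹ * G ξ)) (torus N r) := fun i =>
    continuousOn_const.mul ((hr.continuousOn_inv i).mul hG)
  have hc2 : ∀ i : Fin N, ContinuousOn (fun ξ => (1 - p) * (ξ i * G ξ)) (torus N r) := fun i =>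
    continuousOn_const.mul (ContinuousOn.mul (by fun_prop) hG)
  have hc3 : ∀ i : Fin N, ContinuousOn (fun ξ => ε p (ξ i) * G ξ) (torus N r) := fun i => by
    unfold ε
    exact (((continuousOn_const.mul (hr.continuousOn_inv i)).add (by fun_prop)).sub
      continuousOn_const).mul hG
  simp only [sum_mul]
  rw [transform_sum hr _ fun i _ => hc3 i]
  refine sum_congr rfl fun i _ => ?_
  rw [transform_add_single hr, transform_sub_single hr, ← transform_const_mul,
    ← transform_const_mul,
    ← transform_add hr (hc1 i) (hc2 i), ← transform_sub hr ((hc1 i).fun_add (hc2 i)) hG]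
  congr 1
  ext ξ
  simp only [ε]
  ring

theorem SmallRadius.continuousOn_bethe (hr : SmallRadius p r) (k : ℕ) (x : Fin N → ℤ) :
    ContinuousOn (bethe p k x) (torus N r) := by
  unfold bethe
  refine ContinuousOn.mul (ContinuousOn.mul ?_ ?_) (hr.continuousOn_prod_zpow x)
  · unfold f
    fun_prop
  · refine ContinuousOn.div (continuousOn_const.mul (continuous_vandermonde _).continuousOn)
      (by fun_prop) fun ξ hξ => prod_ne_zero_iff.2 fun j _ => ?_
    exact sub_ne_zero.2 (hr.ne_one hξ j).symm

theorem ContinuousOn.comp_perm {G : (Fin N → ℂ) → ℂ} (hG : ContinuousOn G (torus N r))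
    (σ : Equiv.Perm (Fin N)) : ContinuousOn (fun ξ => G (ξ ∘ σ)) (torus N r) :=
  hG.comp (by fun_prop) fun _ h => torus_comp h σ

theorem continuousOn_asym {Φ : (Fin N → ℂ) → ℂ} (hΦ : ContinuousOn Φ (torus N r)) :
    ContinuousOn (asym Φ) (torus N r) :=
  continuousOn_finsetSum _ fun σ _ => continuousOn_const.mul (ContinuousOn.comp_perm hΦ σ)

theorem transform_asym (hr : SmallRadius p r) {Φ : (Fin N → ℂ) → ℂ}
    (hΦ : ContinuousOn Φ (torus N r)) (y : Fin N → ℤ) :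
    transform p r (asym Φ) y = ∑ σ : Equiv.Perm (Fin N), (Equiv.Perm.sign σ : ℂ) *
      transform p r (fun ξ => Φ (ξ ∘ σ)) y := by
  have hc : ∀ σ : Equiv.Perm (Fin N),
      ContinuousOn (fun ξ => (Equiv.Perm.sign σ : ℂ) * Φ (ξ ∘ σ)) (torus N r) := fun σ =>
    continuousOn_const.mul (ContinuousOn.comp_perm hΦ σ)
  unfold asym
  rw [transform_sum hr _ fun σ _ => hc σ]
  exact sum_congr rfl fun σ _ => transform_const_mul _ _ _

theorem contour_eq_zero_of_zpow (hr : SmallRadius p r) {A : (Fin N → ℂ) → ℂ}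
    (hA : ContinuousOn A (torus N r)) {a : Fin N}
    (hd : ∀ ξ ∈ torus N r,
      DifferentiableOn ℂ (fun z => A (Function.update ξ a z)) (Metric.closedBall 0 r))
    {m : Fin N → ℤ} (hm : 0 ≤ m a) : contour r (fun ξ => A ξ * ∏ i, ξ i ^ m i) = 0 := by
  refine contour_eq_zero hr.pos a (hA.mul (hr.continuousOn_prod_zpow m)) _ (fun _ _ => rfl)
    fun ξ hξ => (hd ξ hξ).mul ?_
  refine DifferentiableOn.fun_finsetProd fun i _ => ?_
  by_cases h : i = a
  · subst h
    simp only [Function.update_self]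
    exact differentiableOn_id.zpow (Or.inr hm)
  · simp only [Function.update_of_ne h]
    exact differentiableOn_const _

/-- The variable `ξ (σ i)` occurs with the exponent `x i - y (σ i) - 1 ≥ 0`, and the other factors
are holomorphic in it on the closed disc, since neither `f` nor `1 - ξ` vanishes there. -/
theorem transform_bethe_comp_eq_zero (hr : SmallRadius p r) (k : ℕ) {x y : Fin N → ℤ}
    (σ : Equiv.Perm (Fin N)) (i : Fin N) (hi : y (σ i) < x i) :
    transform p r (fun ξ => bethe p k x (ξ ∘ σ)) y = 0 := by
  set A : (Fin N → ℂ) → ℂ := fun ξ =>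
    ((∏ i ∈ (tail k)ᶜ, ∏ j ∈ Ioi i, f p (ξ (σ i)) (ξ (σ j))) *
    ((p : ℂ) ^ ((N - k) * (N - k - 1) / 2) * vandermonde (tail k) (ξ ∘ σ) /
      ∏ j ∈ tail k, (1 - ξ (σ j)))) / pairProd p ξ with hAdef
  have hne1 : ∀ z : ℂ, ‖z‖ ≤ r → 1 - z ≠ 0 := fun z hz h => by
    rw [← sub_eq_zero.1 h, norm_one] at hz
    exact hr.lt_one.not_ge hz
  have hA : ContinuousOn A (torus N r) := by
    refine ContinuousOn.div (ContinuousOn.mul ?_ (ContinuousOn.div (ContinuousOn.mul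
      continuousOn_const ((continuous_vandermonde _).comp (by fun_prop)).continuousOn)
      (by fun_prop) ?_)) (continuous_pairProd p).continuousOn ?_
    · unfold f; fun_prop
    · exact fun ξ hξ => prod_ne_zero_iff.2 fun j _ => hne1 _ (hξ _).le
    · exact fun ξ hξ => hr.pairProd_ne_zero fun i => (hξ i).le
  have hd : ∀ ξ ∈ torus N r, DifferentiableOn ℂ (fun z => A (Function.update ξ (σ i) z))
      (Metric.closedBall 0 r) := by
    intro ξ hξ
    have hu : ∀ j, Differentiable ℂ fun z => Function.update ξ (σ i) z j := by
      intro j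
      by_cases h : j = σ i
      · subst h; simp only [Function.update_self]; fun_prop
      · simp only [Function.update_of_ne h]; fun_prop
    have hn : ∀ z ∈ Metric.closedBall (0 : ℂ) r, ∀ j, ‖Function.update ξ (σ i) z j‖ ≤ r := by
      intro z hz j
      by_cases h : j = σ i
      · subst h; simpa using hz
      · simp only [Function.update_of_ne h]; exact (hξ j).le
    have hf : ∀ a b, Differentiable ℂ fun z =>
        f p (Function.update ξ (σ i) z a) (Function.update ξ (σ i) z b) := by
      intro a b
      unfold f
      exact ((differentiable_const _).add (((differentiable_const _).mul (hu a)).mul (hu b))).sub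
        (hu a)
    refine DifferentiableOn.div (DifferentiableOn.mul ?_ (DifferentiableOn.div
      (DifferentiableOn.mul (differentiableOn_const _) ?_) ?_ ?_)) ?_ ?_
    · exact (Differentiable.fun_finsetProd fun a _ => Differentiable.fun_finsetProd fun b _ =>
        hf _ _).differentiableOn
    · unfold vandermonde
      exact (Differentiable.fun_finsetProd fun a _ => Differentiable.fun_finsetProd fun b _ =>
        (hu _).sub (hu _)).differentiableOn
    · exact (Differentiable.fun_finsetProd fun a _ =>
        (differentiable_const _).sub (hu _)).differentiableOn
    · exact fun z hz => prod_ne_zero_iff.2 fun j _ => hne1 _ (hn z hz _)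
    · unfold pairProd
      exact (Differentiable.fun_finsetProd fun a _ => Differentiable.fun_finsetProd fun b _ =>
        hf _ _).differentiableOn
    · exact fun z hz => hr.pairProd_ne_zero (hn z hz)
  rw [← contour_eq_zero_of_zpow hr hA hd (m := fun j => x (σ.symm j) - y j - 1)
    (by simp only [Equiv.symm_apply_apply]; omega)]
  refine contour_congr hr.pos.le fun ξ hξ => ?_
  have h1 : ∏ j, ξ j ^ (x (σ.symm j) - y j - 1) =
      (∏ j, (ξ ∘ σ) j ^ x j) * ∏ j, ξ j ^ (-y j - 1) := by
    rw [← Equiv.prod_comp σ.symm fun j => (ξ ∘ σ) j ^ x j, ← prod_mul_distrib]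
    refine prod_congr rfl fun j _ => ?_
    rw [Function.comp_apply, Equiv.apply_symm_apply, ← zpow_add₀ (hr.ne_zero hξ j)]
    congr 1
    ring
  simp only [h1, hAdef, bethe, Function.comp_apply]
  ring

theorem bethe_add_single (p : ℝ) (k : ℕ) (x : Fin N → ℤ) (i : Fin N) (d : ℤ) {ζ : Fin N → ℂ}
    (h0 : ∀ i, ζ i ≠ 0) : bethe p k (x + Pi.single i d) ζ = bethe p k x ζ * ζ i ^ d := by
  rw [bethe, prod_zpow_add_single x i d h0, bethe]
  ring

theorem bethe_self (p : ℝ) (x : Fin N → ℤ) (ζ : Fin N → ℂ) :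
    bethe p N x ζ = pairProd p ζ * ∏ i, ζ i ^ x i := by
  have h : tail (N := N) N = ∅ := by
    ext i
    simp [mem_tail]
  rw [bethe, h, pairProd]
  simp [vandermonde]

/-- The eigenvalue relation for the free adjoint generator in the final configuration. -/
theorem sum_free_asym_bethe (hr : SmallRadius p r) (k : ℕ) (x : Fin N → ℤ) {ξ : Fin N → ℂ}
    (hξ : ξ ∈ torus N r) :
    ∑ i, ((1 - p) * asym (bethe p k (x + Pi.single i 1)) ξ +
        p * asym (bethe p k (x - Pi.single i 1)) ξ - asym (bethe p k x) ξ) =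
      (∑ i, ε p (ξ i)) * asym (bethe p k x) ξ := by
  simp only [asym, mul_sum, ← sum_add_distrib, ← sum_sub_distrib]
  rw [sum_comm]
  refine sum_congr rfl fun σ _ => ?_
  have h0 : ∀ i, (ξ ∘ σ) i ≠ 0 := fun i => hr.ne_zero hξ _
  rw [← Equiv.sum_comp σ fun i => ε p (ξ i), sum_mul]
  refine sum_congr rfl fun i _ => ?_
  rw [sub_eq_add_neg x, ← Pi.single_neg, bethe_add_single p k x i 1 h0,
    bethe_add_single p k x i (-1) h0, zpow_one, zpow_neg_one, ε]
  simp only [Function.comp_apply]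
  ring

/-- The boundary condition in the final configuration. -/
theorem asym_bethe_boundary (hr : SmallRadius p r) {c s : Fin N} (hcs : (c : ℕ) + 1 = s)
    {x : Fin N → ℤ} (hx : x s = x c + 1) {ξ : Fin N → ℂ} (hξ : ξ ∈ torus N r) :
    (1 - p) * asym (bethe p N (x + Pi.single c 1)) ξ +
      p * asym (bethe p N (x - Pi.single s 1)) ξ = asym (bethe p N x) ξ := by
  have hne : c ≠ s := by rintro rfl; omega
  rw [← sub_eq_zero]
  -- Now `(1 - p) ζ_c + p / ζ_s - 1 = f p ζ_s ζ_c / ζ_s`. It supplies the partner of the factor `f p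
  -- ζ_c ζ_s` of `pairProd`, and the exponents at `c` and `s` agree, so the function is symmetric in
  -- the two variables.
  have e : (1 - p) * asym (bethe p N (x + Pi.single c 1)) ξ +
      p * asym (bethe p N (x - Pi.single s 1)) ξ - asym (bethe p N x) ξ =
      asym (fun ζ => pairProd p ζ * f p (ζ s) (ζ c) * ∏ i, ζ i ^ (x - Pi.single s 1 : Fin N → ℤ) i) ξ := by
    simp only [asym, mul_sum, ← sum_add_distrib, ← sum_sub_distrib]
    refine sum_congr rfl fun σ _ => ?_
    have h0 : ∀ i, (ξ ∘ σ) i ≠ 0 := fun i => hr.ne_zero hξ _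
    have := h0 s
    rw [sub_eq_add_neg x, ← Pi.single_neg, bethe_add_single p N x c 1 h0,
      bethe_add_single p N x s (-1) h0, prod_zpow_add_single x s (-1) h0, bethe_self, f,
      zpow_one, zpow_neg_one]
    field_simp
    ring
  rw [e]
  refine asym_eq_zero_of_symm hne fun σ => ?_
  rw [prod_zpow_swap_of_eq (by simp [hne, hx])]
  simp only [Function.comp_apply, Equiv.swap_apply_left, Equiv.swap_apply_right]
  have := pairProd_swap p hcs (ξ ∘ σ)
  simp only [Function.comp_apply] at this
  rw [this]

end transform

/-! ### The initial condition when all positions are prescribed. -/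

theorem pairProd_succ (p : ℝ) {n : ℕ} (ξ : Fin (n + 1) → ℂ) :
    pairProd p ξ = (∏ j : Fin n, f p (ξ 0) (ξ j.succ)) * pairProd p (Fin.tail ξ) := by
  rw [pairProd, Fin.prod_univ_succ, Fin.prod_Ioi_zero, pairProd]
  simp only [Fin.prod_Ioi_succ]
  rfl

section

variable {p r : ℝ}

/-- Permutations that move `0` contribute nothing, since the integrand has no pole at `ξ 0 = 0`. For
those fixing `0`, the factors `f p (ξ 0) (ξ j)` cancel and the integral over `ξ 0` is that of `ξ 0 ^
(x 0 - y 0 - 1)`. -/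
theorem transform_asym_bethe_succ (hr : SmallRadius p r) {n : ℕ} {x y : Fin (n + 1) → ℤ}
    (hxy : ∀ i, i ≠ 0 → y 0 < x i) :
    transform p r (asym (bethe p (n + 1) x)) y =
      (if x 0 = y 0 then 1 else 0) *
        transform p r (asym (bethe p n (Fin.tail x))) (Fin.tail y) := by
  rw [transform_asym hr (hr.continuousOn_bethe _ _), transform_asym hr (hr.continuousOn_bethe _ _),
    ← Equiv.sum_comp Equiv.Perm.decomposeFin.symm, ← univ_product_univ, sum_product,
    Fin.sum_univ_succ, mul_sum, sum_eq_zero (s := (univ : Finset (Fin n))), add_zero]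
  · refine sum_congr rfl fun σ _ => ?_
    rw [Equiv.Perm.decomposeFin.symm_sign, if_pos rfl, one_mul]
    set τ := Equiv.Perm.decomposeFin.symm ((0 : Fin (n + 1)), σ) with hτ
    have h0 : τ 0 = 0 := by simp [hτ]
    have hs : ∀ i : Fin n, τ i.succ = (σ i).succ := by
      intro i
      simp [hτ]
    rw [mul_left_comm]
    congr 1
    have hc := hr.continuousOn_kernel
      (ContinuousOn.comp_perm (hr.continuousOn_bethe n (Fin.tail x)) σ) (Fin.tail y)
    have key := contour_cons_zpow hr.pos (x 0 - y 0 - 1) hc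
    have e : (x 0 - y 0 - 1 = -1) ↔ x 0 = y 0 := by omega
    simp only [e] at key
    rw [transform, transform, ← key]
    refine contour_congr hr.pos.le fun ξ hξ => ?_
    have ht : ∀ i, ‖Fin.tail ξ i‖ ≤ r := fun i => (hξ i.succ).le
    have hξ0 := hr.ne_zero hξ 0
    have e1 : Fin.tail (ξ ∘ τ) = Fin.tail ξ ∘ σ := by
      ext i
      simp [Fin.tail, hs]
    have e2 : ∏ j : Fin n, f p ((ξ ∘ τ) 0) ((ξ ∘ τ) j.succ) = ∏ j : Fin n, f p (ξ 0) (ξ j.succ) := by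
      simp only [Function.comp_apply, h0, hs]
      exact Equiv.prod_comp σ fun j => f p (ξ 0) (ξ j.succ)
    have e3 : ∏ j : Fin n, f p (ξ 0) (ξ j.succ) ≠ 0 := prod_ne_zero_iff.2 fun j _ =>
      hr.f_ne_zero _ _ (hξ _).le (hξ _).le
    have e4 := hr.pairProd_ne_zero ht
    have hz : ξ 0 ^ (x 0 - y 0 - 1) = ξ 0 ^ x 0 * ξ 0 ^ (-y 0 - 1) := by
      rw [← zpow_add₀ hξ0]
      congr 1
      ring
    simp only [bethe_self]
    rw [pairProd_succ p ξ, pairProd_succ p (ξ ∘ τ), e1, e2, Fin.prod_univ_succ,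
      Fin.prod_univ_succ (fun i => ξ i ^ (-y i - 1)), hz]
    simp only [Function.comp_apply, h0, hs, Fin.tail]
    field_simp
  · intro a _
    refine sum_eq_zero fun σ _ => ?_
    set τ := Equiv.Perm.decomposeFin.symm (a.succ, σ) with hτ
    have h0 : τ 0 ≠ 0 := by simp [hτ, Fin.succ_ne_zero]
    rw [transform_bethe_comp_eq_zero hr _ τ (τ.symm 0), mul_zero]
    rw [Equiv.apply_symm_apply]
    refine hxy _ fun h => h0 ?_
    rw [Equiv.symm_apply_eq] at h
    exact h.symm

/-- The commutation of the Bethe kernel with the generator. -/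
theorem transform_asym_bethe_comm (hr : SmallRadius p r) {n : ℕ} {x y : Fin (n + 1) → ℤ}
    (hx : StrictMono x) (hy : StrictMono y) :
    ∑ i, (p * (open Classical in if StrictMono (y + Pi.single i 1) then
          transform p r (asym (bethe p (n + 1) x)) (y + Pi.single i 1) else 0) +
        (1 - p) * (open Classical in if StrictMono (y - Pi.single i 1) then
          transform p r (asym (bethe p (n + 1) x)) (y - Pi.single i 1) else 0)) +
        adjacentPairs y * transform p r (asym (bethe p (n + 1) x)) y =
      ∑ i, ((1 - p) * (open Classical in if StrictMono (x + Pi.single i 1) then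
          transform p r (asym (bethe p (n + 1) (x + Pi.single i 1))) y else 0) +
        p * (open Classical in if StrictMono (x - Pi.single i 1) then
          transform p r (asym (bethe p (n + 1) (x - Pi.single i 1))) y else 0)) +
        adjacentPairs x * transform p r (asym (bethe p (n + 1) x)) y := by
  have hG : ∀ x : Fin (n + 1) → ℤ, ContinuousOn (asym (bethe p (n + 1) x)) (torus (n + 1) r) :=
    fun x => continuousOn_asym (hr.continuousOn_bethe _ _)
  -- By the boundary conditions both sides become free sums, which agree because the eigenvalue is
  -- `∑ ε(ξ_i)` in `y` and in `x`. The rates are exchanged in `x`, where the adjoint acts.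
  rw [← sum_free_eq_sum_exclusion hy _ _ (transform p r (asym (bethe p (n + 1) x))),
    ← sum_free_eq_sum_exclusion hx _ _ (fun x => transform p r (asym (bethe p (n + 1) x)) y)]
  · have h1 := sum_free_transform hr (hG x) y
    have h2 : transform p r (fun ξ => (∑ i, ε p (ξ i)) * asym (bethe p (n + 1) x) ξ) y =
        ∑ i, ((1 - p) * transform p r (asym (bethe p (n + 1) (x + Pi.single i 1))) y +
          p * transform p r (asym (bethe p (n + 1) (x - Pi.single i 1))) y -
          transform p r (asym (bethe p (n + 1) x)) y) := by
      have hc1 : ∀ i, ContinuousOn (fun ξ => (1 - p) *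
          asym (bethe p (n + 1) (x + Pi.single i 1)) ξ) (torus (n + 1) r) := fun i =>
        continuousOn_const.mul (hG _)
      have hc2 : ∀ i, ContinuousOn (fun ξ => p *
          asym (bethe p (n + 1) (x - Pi.single i 1)) ξ) (torus (n + 1) r) := fun i =>
        continuousOn_const.mul (hG _)
      have hc3 : ∀ i, ContinuousOn (fun ξ => (1 - p) *
          asym (bethe p (n + 1) (x + Pi.single i 1)) ξ + p *
          asym (bethe p (n + 1) (x - Pi.single i 1)) ξ - asym (bethe p (n + 1) x) ξ)
          (torus (n + 1) r) := fun i => ((hc1 i).fun_add (hc2 i)).fun_sub (hG x)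
      rw [transform_congr hr fun ξ hξ => (sum_free_asym_bethe hr (n + 1) x hξ).symm,
        transform_sum hr _ fun i _ => hc3 i]
      refine sum_congr rfl fun i _ => ?_
      rw [transform_sub hr ((hc1 i).fun_add (hc2 i)) (hG x), transform_add hr (hc1 i) (hc2 i),
        transform_const_mul, transform_const_mul]
    rw [h2, sum_sub_distrib, sum_sub_distrib] at h1
    exact sub_left_inj.1 h1
  · intro j hj
    have hc1 : ContinuousOn (fun ξ => (1 - p) *
        asym (bethe p (n + 1) (x + Pi.single j.castSucc 1)) ξ) (torus (n + 1) r) :=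
      continuousOn_const.mul (hG _)
    have hc2 : ContinuousOn (fun ξ => p *
        asym (bethe p (n + 1) (x - Pi.single j.succ 1)) ξ) (torus (n + 1) r) :=
      continuousOn_const.mul (hG _)
    rw [← transform_const_mul, ← transform_const_mul, ← transform_add hr hc1 hc2]
    exact transform_congr hr (fun ξ hξ => asym_bethe_boundary hr (by simp) hj hξ) y
  · intro j hj
    refine transform_boundary hr (hG x) (by simp) (fun ξ _ => ?_) hj
    rw [asym_comp, Equiv.Perm.sign_swap (by simp [Fin.ext_iff])]
    simp

theorem indicator_comm (a b : ℂ) {n : ℕ} {x y : Fin (n + 1) → ℤ}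
    (hx : StrictMono x) (hy : StrictMono y) :
    ∑ i, (a * (open Classical in if StrictMono (y + Pi.single i 1) then
          (if x = y + Pi.single i 1 then (1 : ℂ) else 0) else 0) +
        b * (open Classical in if StrictMono (y - Pi.single i 1) then
          (if x = y - Pi.single i 1 then 1 else 0) else 0)) +
        adjacentPairs y * (if x = y then 1 else 0) =
      ∑ i, (b * (open Classical in if StrictMono (x + Pi.single i 1) then
          (if x + Pi.single i 1 = y then 1 else 0) else 0) +
        a * (open Classical in if StrictMono (x - Pi.single i 1) then
          (if x - Pi.single i 1 = y then 1 else 0) else 0)) +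
        adjacentPairs x * (if x = y then 1 else 0) := by
  congr 1
  · refine sum_congr rfl fun i _ => ?_
    have h1 : x = y + Pi.single i 1 ↔ x - Pi.single i 1 = y := sub_eq_iff_eq_add.symm
    have h2 : x = y - Pi.single i 1 ↔ x + Pi.single i 1 = y := eq_sub_iff_add_eq
    rw [add_comm]
    congr 2
    · by_cases h : x = y - Pi.single i 1
      · rw [if_pos h, if_pos (h2.1 h), if_pos (h ▸ hx), if_pos (h2.1 h ▸ hy)]
      · rw [if_neg h, if_neg fun h' => h (h2.2 h'), ite_self, ite_self]
    · by_cases h : x = y + Pi.single i 1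
      · rw [if_pos h, if_pos (h1.1 h), if_pos (h ▸ hx), if_pos (h1.1 h ▸ hy)]
      · rw [if_neg h, if_neg fun h' => h (h1.2 h'), ite_self, ite_self]
  · by_cases h : x = y
    · rw [h]
    · simp [h]

/-- The deviation of the Bethe kernel from the identity. -/
noncomputable def deviation (p r : ℝ) {N : ℕ} (x y : Fin N → ℤ) : ℂ :=
  transform p r (asym (bethe p N x)) y - if x = y then 1 else 0

theorem deviation_comm (hr : SmallRadius p r) {n : ℕ} {x y : Fin (n + 1) → ℤ}
    (hx : StrictMono x) (hy : StrictMono y) :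
    ∑ i, (p * (open Classical in if StrictMono (y + Pi.single i 1) then
          deviation p r x (y + Pi.single i 1) else 0) +
        (1 - p) * (open Classical in if StrictMono (y - Pi.single i 1) then
          deviation p r x (y - Pi.single i 1) else 0)) +
        adjacentPairs y * deviation p r x y =
      ∑ i, ((1 - p) * (open Classical in if StrictMono (x + Pi.single i 1) then
          deviation p r (x + Pi.single i 1) y else 0) +
        p * (open Classical in if StrictMono (x - Pi.single i 1) then
          deviation p r (x - Pi.single i 1) y else 0)) +
        adjacentPairs x * deviation p r x y := by
  classical
  have h1 := transform_asym_bethe_comm hr hx hy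
  have h2 := indicator_comm p (1 - p) hx hy
  have hsub : ∀ (P : Prop) [Decidable P] (u v : ℂ),
      (if P then u - v else 0) = (if P then u else 0) - if P then v else 0 := by
    intro P _ u v
    split_ifs <;> simp
  simp only [deviation, hsub, mul_sub, sum_sub_distrib, sum_add_distrib] at h1 h2 ⊢
  linear_combination h1 - h2

theorem deviation_eq_zero_of_forall_lt (hr : SmallRadius p r) {n : ℕ}
    (ih : ∀ x y : Fin n → ℤ, StrictMono x → StrictMono y →
      transform p r (asym (bethe p n x)) y = if x = y then 1 else 0)
    {x y : Fin (n + 1) → ℤ} (hx : StrictMono x) (hy : StrictMono y)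
    (hxy : ∀ i, i ≠ 0 → y 0 < x i) : deviation p r x y = 0 := by
  have htail : ∀ {x : Fin (n + 1) → ℤ}, StrictMono x → StrictMono (Fin.tail x) :=
    fun h a b hab => h (Fin.succ_lt_succ_iff.2 hab)
  rw [deviation, transform_asym_bethe_succ hr hxy, ih _ _ (htail hx) (htail hy), sub_eq_zero]
  by_cases h0 : x 0 = y 0
  · have : Fin.tail x = Fin.tail y ↔ x = y := by
      constructor
      · intro h
        rw [← Fin.cons_self_tail x, ← Fin.cons_self_tail y, h, h0]
      · rintro rfl; rfl
    simp [h0, this]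
  · have : x ≠ y := fun h => h0 (by rw [h])
    simp [h0, this]

/-- The commutation relation is taken at `x` and `y' = y - e₀`. All terms have gap at most `d`,
hence vanish, except those at `(x, y' + e₀)` and `(x - e₀, y')`, which both carry the rate `p ≠ 0`.
-/
theorem deviation_sub_single_zero (hp : p ≠ 0) (hr : SmallRadius p r) {n : ℕ} {d : ℤ}
    (ih : ∀ x y : Fin (n + 1) → ℤ, StrictMono x → StrictMono y → y 0 - x 0 ≤ d →
      deviation p r x y = 0)
    {x y : Fin (n + 1) → ℤ} (hx : StrictMono x) (hy : StrictMono y) (hxy : y 0 - x 0 ≤ d + 1) :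
    deviation p r x y = deviation p r (x - Pi.single 0 1) (y - Pi.single 0 1) := by
  classical
  have hy' := strictMono_sub_single_zero hy
  have hx' := strictMono_sub_single_zero hx
  have key := deviation_comm hr hx hy'
  set y' := y - Pi.single 0 1 with hy'def
  have hyy : y' + Pi.single 0 1 = y := by simp [hy'def]
  have hy0 : y' 0 = y 0 - 1 := by simp [hy'def]
  rw [ih x y' hx hy' (by omega), Fin.sum_univ_succ, Fin.sum_univ_succ, hyy, if_pos hy, if_pos hx',
    sum_eq_zero, sum_eq_zero] at key
  · have h1 : ∀ h : StrictMono (y' - Pi.single 0 1), deviation p r x (y' - Pi.single 0 1) = 0 :=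
      fun h => ih _ _ hx h (by simp; omega)
    have h2 : ∀ h : StrictMono (x + Pi.single 0 1), deviation p r (x + Pi.single 0 1) y' = 0 :=
      fun h => ih _ _ h hy' (by simp; omega)
    have h3 : (if StrictMono (y' - Pi.single 0 1) then
        deviation p r x (y' - Pi.single 0 1) else 0) = 0 := by
      split_ifs with h
      · exact h1 h
      · rfl
    have h4 : (if StrictMono (x + Pi.single 0 1) then
        deviation p r (x + Pi.single 0 1) y' else 0) = 0 := by
      split_ifs with h
      · exact h2 h
      · rfl
    rw [h3, h4] at key
    have hp' : (p : ℂ) ≠ 0 := by exact_mod_cast hp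
    refine mul_left_cancel₀ hp' ?_
    linear_combination key
  · intro i _
    have h3 : (if StrictMono (x + Pi.single i.succ 1) then
        deviation p r (x + Pi.single i.succ 1) y' else 0) = 0 := by
      split_ifs with h
      · exact ih _ _ h hy' (by simp; omega)
      · rfl
    have h4 : (if StrictMono (x - Pi.single i.succ 1) then
        deviation p r (x - Pi.single i.succ 1) y' else 0) = 0 := by
      split_ifs with h
      · exact ih _ _ h hy' (by simp; omega)
      · rfl
    rw [h3, h4]
    simp
  · intro i _
    have h3 : (if StrictMono (y' + Pi.single i.succ 1) then
        deviation p r x (y' + Pi.single i.succ 1) else 0) = 0 := by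
      split_ifs with h
      · exact ih _ _ hx h (by simp; omega)
      · rfl
    have h4 : (if StrictMono (y' - Pi.single i.succ 1) then
        deviation p r x (y' - Pi.single i.succ 1) else 0) = 0 := by
      split_ifs with h
      · exact ih _ _ hx h (by simp; omega)
      · rfl
    rw [h3, h4]
    simp

theorem transform_asym_bethe_self (hp : p ≠ 0) (hr : SmallRadius p r) (N : ℕ) (x y : Fin N → ℤ)
    (hx : StrictMono x) (hy : StrictMono y) :
    transform p r (asym (bethe p N x)) y = if x = y then 1 else 0 := by
  induction N with
  | zero =>
    rw [transform, contour_of_isEmpty, if_pos (Subsingleton.elim _ _)]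
    simp [asym, bethe_self, pairProd]
  | succ n ih =>
    rw [← sub_eq_zero]
    change deviation p r x y = 0
    -- Induction on a bound for `y 0 - x 0`. If `y 0 ≤ x 0`, then `y 0 < x i` for all `i ≠ 0` by
    -- strict monotonicity.
    have hd : ∀ d : ℕ, ∀ x y : Fin (n + 1) → ℤ, StrictMono x → StrictMono y → y 0 - x 0 ≤ d →
        deviation p r x y = 0 := by
      intro d
      induction d with
      | zero =>
        intro x y hx hy hxy
        refine deviation_eq_zero_of_forall_lt hr ih hx hy fun i hi => ?_
        have := hx (Fin.pos_of_ne_zero hi)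
        push_cast at hxy
        omega
      | succ d ihd =>
        intro x y hx hy hxy
        -- `m` bounds the number of left moves of the first particles of `x` and `y` needed until `y
        -- 0 < x i` for all `i ≠ 0`; these moves preserve the gap `y 0 - x 0`.
        have hm : ∀ m : ℕ, ∀ x y : Fin (n + 1) → ℤ, StrictMono x → StrictMono y →
            y 0 - x 0 ≤ (d + 1 : ℕ) → (∀ i, i ≠ 0 → y 0 - m < x i) → deviation p r x y = 0 := by
          intro m
          induction m with
          | zero =>
            intro x y hx hy _ h
            exact deviation_eq_zero_of_forall_lt hr ih hx hy (by simpa using h)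
          | succ m ihm =>
            intro x y hx hy hxy h
            rw [deviation_sub_single_zero hp hr ihd hx hy (by push_cast at hxy; exact hxy)]
            refine ihm _ _ (strictMono_sub_single_zero hx) (strictMono_sub_single_zero hy)
              (by simpa using hxy) fun i hi => ?_
            have := h i hi
            simp only [Pi.sub_apply, Pi.single_eq_same, Pi.single_eq_of_ne hi, sub_zero]
            push_cast at this
            omega
        refine hm (y 0 - x 0).toNat x y hx hy hxy fun i hi => ?_
        have := hx (Fin.pos_of_ne_zero hi)
        have := Int.self_le_toNat (y 0 - x 0)
        omega
    exact hd (y 0 - x 0).toNat x y hx hy (Int.self_le_toNat _)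

/-! ### Summing out the particles whose positions are not prescribed. -/

/-- The contour integral for the probability that the particles `0, …, k - 1` are at `x` and the
others at or to the right of the common value of `x`, at time `0`. -/
theorem transform_asym_bethe (hp : p ≠ 0) (hr : SmallRadius p r) {N : ℕ} {y : Fin N → ℤ}
    (hy : StrictMono y) {k : ℕ} (hk : k ≤ N) (x : Fin N → ℤ)
    (hx : ∀ i j : Fin N, (i : ℕ) < k → i < j → x i < x j)
    (hx' : ∀ i j : Fin N, k ≤ i → k ≤ j → x i = x j) :
    transform p r (asym (bethe p k x)) y =
      (N - k)! * if ∀ i : Fin N, if (i : ℕ) < k then x i = y i else x i ≤ y i then 1 else 0 := by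
  induction hk using Nat.decreasingInduction generalizing x with
  | self =>
    rw [transform_asym_bethe_self hp hr N x y (fun i j => hx i j i.isLt) hy]
    simp [funext_iff]
  | of_succ k hkN ih =>
    let κ : Fin N := ⟨k, hkN⟩
    let last : Fin N := ⟨N - 1, by omega⟩
    -- The common tail position is pushed to the right until it exceeds `y last`. Then every
    -- permutation contributes zero, and so does the indicator.
    have hstep : ∀ m : ℕ, ∀ x : Fin N → ℤ,
        (∀ i j : Fin N, (i : ℕ) < k → i < j → x i < x j) →
        (∀ i j : Fin N, k ≤ i → k ≤ j → x i = x j) → y last + 1 - x κ ≤ m →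
        transform p r (asym (bethe p k x)) y =
          (N - k)! * if ∀ i : Fin N, if (i : ℕ) < k then x i = y i else x i ≤ y i
            then 1 else 0 := by
      intro m
      induction m with
      | zero =>
        intro x hx hx' hm
        have hlast : ∀ i, y i ≤ y last := fun i => hy.monotone (Fin.le_def.2 (by
          have := i.isLt
          simp only [last]
          omega))
        have hxl : x last = x κ := hx' _ _ (by simp only [last]; omega) le_rfl
        rw [transform_asym hr (hr.continuousOn_bethe _ _), sum_eq_zero, if_neg, mul_zero]
        · intro h
          have := h last
          rw [if_neg (by simp only [last]; omega)] at this
          push_cast at hm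
          omega
        · intro σ _
          rw [transform_bethe_comp_eq_zero hr k σ last, mul_zero]
          have := hlast (σ last)
          push_cast at hm
          omega
      | succ m ihm =>
        intro x hx hx' hm
        let x1 : Fin N → ℤ := fun i => if κ < i then x i + 1 else x i
        let x2 : Fin N → ℤ := fun i => if k ≤ i then x i + 1 else x i
        have hG : ∀ k (x : Fin N → ℤ), ContinuousOn (asym (bethe p k x)) (torus N r) :=
          fun k x => continuousOn_asym (hr.continuousOn_bethe _ _)
        have h1 : transform p r (asym (bethe p k x)) y - transform p r (asym (bethe p k x2)) y =
            (N - k : ℕ) * transform p r (asym (bethe p (k + 1) x1)) y := by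
          rw [← transform_sub hr (hG _ _) (hG _ _), ← transform_const_mul]
          exact transform_congr hr (fun ξ hξ => asym_bethe_sub (k := κ) hp
            (fun i hi => hx' _ _ (mem_tail.1 hi) le_rfl) (fun i => rfl) (fun i => rfl)
            (hr.ne_zero hξ) (hr.ne_one hξ)) y
        have hκ : ∀ i : Fin N, κ < i ↔ k < (i : ℕ) := fun i => Fin.lt_def
        rw [ih x1 ?_ ?_, ihm x2 ?_ ?_ ?_] at h1
        · have hfac : ((N - k : ℕ) : ℂ) * ((N - (k + 1))! : ℕ) = ((N - k)! : ℕ) := by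
            rw [← Nat.cast_mul, show N - k = (N - (k + 1)) + 1 by omega, ← Nat.factorial_succ]
          rw [← mul_assoc, hfac, sub_eq_iff_eq_add] at h1
          -- What remains is `1{x κ ≤ y κ} = 1{x κ = y κ} + 1{x κ + 1 ≤ y κ}`; the later particles
          -- satisfy `x i + 1 ≤ y i` automatically because `y` is strictly increasing.
          rw [h1, ← mul_add]
          congr 1
          by_cases ha : ∀ i : Fin N, (i : ℕ) < k → x i = y i
          · by_cases hb : x κ ≤ y κ
            · have hge : ∀ i : Fin N, k < (i : ℕ) → x i + 1 ≤ y i := by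
                intro i hi
                have h2 := hy ((hκ i).2 hi)
                have h3 := hx' i κ hi.le le_rfl
                omega
              have hall : ∀ i : Fin N, if (i : ℕ) < k then x i = y i else x i ≤ y i := by
                intro i
                split_ifs with h
                · exact ha i h
                · rcases (not_lt.1 h).eq_or_lt with h' | h'
                  · have : i = κ := Fin.ext h'.symm
                    rw [this]; exact hb
                  · have := hge i h'; omega
              rw [if_pos hall]
              by_cases hc : x κ = y κ
              · rw [if_pos, if_neg, add_zero]
                · intro h
                  have := h κ
                  simp [κ, x2] at this
                  change x κ + 1 ≤ y κ at this
                  omega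
                · intro i
                  simp only [x1, hκ]
                  split_ifs with h1 h2 h2
                  · omega
                  · rcases (Nat.lt_succ_iff.1 h1).eq_or_lt with h' | h'
                    · have : i = κ := Fin.ext h'
                      rw [this]; exact hc
                    · exact ha i h'
                  · exact hge i h2
                  · omega
              · rw [if_neg, if_pos, zero_add]
                · intro i
                  simp only [x2]
                  split_ifs with h1 h2 h2
                  · omega
                  · exact ha i h1
                  · rcases h2.eq_or_lt with h' | h'
                    · have : i = κ := Fin.ext h'.symm
                      rw [this]; omega
                    · exact hge i h'
                  · omega
                · intro h
                  have := h κ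
                  simp [κ, x1] at this
                  exact hc this
            · rw [if_neg, if_neg, if_neg, add_zero]
              · intro h
                have := h κ
                simp [κ] at this
                exact hb this
              · intro h
                have := h κ
                simp [κ, x2] at this
                change x κ + 1 ≤ y κ at this
                omega
              · intro h
                have := h κ
                simp [κ, x1] at this
                exact hb (le_of_eq this)
          · push Not at ha
            obtain ⟨i, hi, hne⟩ := ha
            rw [if_neg, if_neg, if_neg, add_zero]
            · intro h
              have := h i
              rw [if_pos hi] at this
              exact hne this
            · intro h
              have := h i
              rw [if_pos hi] at this
              simp only [x2] at this
              rw [if_neg (by omega)] at this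
              exact hne this
            · intro h
              have := h i
              rw [if_pos (by omega)] at this
              simp only [x1, hκ] at this
              rw [if_neg (by omega)] at this
              exact hne this
        · intro i j hi hij
          have := hx i j hi hij
          simp only [x2]
          split_ifs <;> omega
        · intro i j hi hj
          simp only [x2]
          rw [if_pos hi, if_pos hj, hx' i j hi hj]
        · simp only [x2]
          rw [if_pos le_rfl]
          push_cast at hm
          omega
        · intro i j hi hij
          have hij' : (i : ℕ) < j := hij
          simp only [x1, hκ]
          rw [if_neg (by omega)]
          rcases (Nat.lt_succ_iff.1 hi).eq_or_lt with h' | h'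
          · rw [if_pos (by omega), hx' i j h'.ge (by omega)]
            omega
          · have := hx i j h' hij
            split_ifs <;> omega
        · intro i j hi hj
          simp only [x1, hκ]
          rw [if_pos (by omega), if_pos (by omega), hx' i j (by omega) (by omega)]
    exact hstep (y last + 1 - x κ).toNat x hx hx' (Int.self_le_toNat _)

end

/-! ### From permutations to ordered tuples of distinct indices. -/

section embedding

variable {N k : ℕ}

/-- The images under a permutation of the first `k` indices. -/
def restrict (hk : k ≤ N) (σ : Equiv.Perm (Fin N)) : Fin k ↪ Fin N :=
  (Fin.castLEEmb hk).trans σ.toEmbedding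

theorem restrict_apply (hk : k ≤ N) (σ : Equiv.Perm (Fin N)) (i : Fin k) :
    restrict hk σ i = σ (Fin.castLE hk i) := rfl

theorem exists_restrict_eq (hk : k ≤ N) (l : Fin k ↪ Fin N) : ∃ σ, restrict hk σ = l := by
  classical
  let e : {x // x ∈ Set.range (Fin.castLE hk)} ≃ {x // x ∈ Set.range l} :=
    (Equiv.ofInjective _ (Fin.castLE_injective hk)).symm.trans (Equiv.ofInjective _ l.injective)
  refine ⟨e.extendSubtype, ?_⟩
  ext i
  rw [restrict_apply, e.extendSubtype_apply_of_mem _ ⟨i, rfl⟩]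
  have : (Equiv.ofInjective _ (Fin.castLE_injective hk)).symm
      (⟨Fin.castLE hk i, ⟨i, rfl⟩⟩ : Set.range (Fin.castLE hk)) = i := by
    rw [Equiv.symm_apply_eq]
    rfl
  simp only [e, Equiv.trans_apply]
  rw [this]
  rfl

theorem card_embedding_mul_factorial (hk : k ≤ N) :
    Fintype.card (Fin k ↪ Fin N) * (N - k)! = N ! := by
  rw [Fintype.card_embedding_eq, Fintype.card_fin, Fintype.card_fin, mul_comm]
  exact Nat.factorial_mul_descFactorial hk

/-- Left multiplication by a permutation maps one fibre of `restrict` onto another, so all fibres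
have the same size, and they partition the `N !` permutations. -/
theorem card_filter_restrict_eq (hk : k ≤ N) (l : Fin k ↪ Fin N) :
    #{σ | restrict hk σ = l} = (N - k)! := by
  have h : ∀ l l' : Fin k ↪ Fin N, #{σ | restrict hk σ = l} = #{σ | restrict hk σ = l'} := by
    intro l l'
    obtain ⟨τ, rfl⟩ := exists_restrict_eq hk l
    obtain ⟨τ', rfl⟩ := exists_restrict_eq hk l'
    refine card_nbij' (fun σ => τ' * τ⁻¹ * σ) (fun σ => τ * τ'⁻¹ * σ) ?_ ?_ ?_ ?_
    · intro σ hσ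
      simp only [coe_filter, mem_univ, true_and, Set.mem_ofPred_eq, DFunLike.ext_iff,
        restrict_apply, Equiv.Perm.mul_apply] at hσ ⊢
      intro i
      rw [hσ i]
      simp
    · intro σ hσ
      simp only [coe_filter, mem_univ, true_and, Set.mem_ofPred_eq, DFunLike.ext_iff,
        restrict_apply, Equiv.Perm.mul_apply] at hσ ⊢
      intro i
      rw [hσ i]
      simp
    · intro σ _; simp [mul_assoc]
    · intro σ _; simp [mul_assoc]
  have h1 : ∑ l' : Fin k ↪ Fin N, #{σ | restrict hk σ = l'} = N ! := by
    rw [← card_eq_sum_card_fiberwise (s := univ) (f := restrict hk) fun _ _ => mem_univ _,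
      card_univ, Fintype.card_perm, Fintype.card_fin]
  rw [sum_congr rfl fun l' _ => h l' l, sum_const, card_univ, smul_eq_mul,
    ← card_embedding_mul_factorial hk] at h1
  exact Nat.eq_of_mul_eq_mul_left (Fintype.card_pos_iff.2 ⟨l⟩) h1

theorem sum_perm_restrict (hk : k ≤ N) (ψ : (Fin k ↪ Fin N) → ℂ) :
    ∑ σ, ψ (restrict hk σ) = (N - k)! * ∑ l, ψ l := by
  rw [← sum_fiberwise (univ : Finset (Equiv.Perm (Fin N))) (restrict hk), mul_sum]
  refine sum_congr rfl fun l _ => ?_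
  rw [sum_congr rfl (g := fun _ => ψ l) (fun σ hσ => by rw [(mem_filter.1 hσ).2]), sum_const,
    card_filter_restrict_eq, nsmul_eq_mul]

theorem compl_tail_eq_map (hk : k ≤ N) :
    (tail (N := N) k)ᶜ = univ.map (Fin.castLEEmb hk) := by
  ext i
  simp only [mem_compl, mem_tail, not_le, mem_map, mem_univ, true_and, Fin.castLEEmb_apply]
  exact ⟨fun h => ⟨⟨i, h⟩, rfl⟩, by rintro ⟨a, rfl⟩; exact a.isLt⟩

theorem compl_restrict (hk : k ≤ N) (σ : Equiv.Perm (Fin N)) :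
    compl (restrict hk σ) = (tail (N := N) k).map σ.toEmbedding := by
  have : univ.map (restrict hk σ) = ((tail (N := N) k)ᶜ).map σ.toEmbedding := by
    rw [compl_tail_eq_map hk, map_map]
    rfl
  rw [compl, this]
  ext i
  simp only [mem_compl, mem_map_equiv, not_not]

theorem prod_compl_restrict (hk : k ≤ N) (σ : Equiv.Perm (Fin N)) (g : Fin N → ℂ) :
    ∏ j ∈ compl (restrict hk σ), g j = ∏ i ∈ tail (N := N) k, g (σ i) := by
  rw [compl_restrict, prod_map]
  rfl

theorem prod_pairs_restrict (hk : k ≤ N) (σ : Equiv.Perm (Fin N)) (g : Fin N → Fin N → ℂ) :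
    ∏ i ∈ (tail (N := N) k)ᶜ, ∏ j ∈ Ioi i, g (σ i) (σ j) =
      (∏ i, ∏ j ∈ compl (restrict hk σ), g (restrict hk σ i) j) *
        ∏ i, ∏ j ∈ Ioi i, g (restrict hk σ i) (restrict hk σ j) := by
  rw [compl_tail_eq_map hk, prod_map, ← prod_mul_distrib]
  refine prod_congr rfl fun i _ => ?_
  rw [prod_compl_restrict]
  have h1 : Ioi (Fin.castLEEmb hk i) = tail (N := N) k ∪ (Ioi i).map (Fin.castLEEmb hk) := by
    ext j
    simp only [mem_Ioi, mem_union, mem_tail, mem_map, Fin.castLEEmb_apply, Fin.lt_def,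
      Fin.val_castLE]
    constructor
    · intro h
      by_cases hj : k ≤ j
      · exact Or.inl hj
      · exact Or.inr ⟨⟨j, not_le.1 hj⟩, h, rfl⟩
    · rintro (h | ⟨a, ha, rfl⟩)
      · exact lt_of_lt_of_le i.isLt h
      · exact ha
  rw [h1, prod_union, prod_map]
  · rfl
  · rw [disjoint_left]
    intro j hj hj'
    obtain ⟨a, _, rfl⟩ := mem_map.1 hj'
    rw [mem_tail, Fin.castLEEmb_apply, Fin.val_castLE] at hj
    exact absurd a.isLt (not_lt.2 hj)

/-- Each unordered pair of indices is counted exactly once, whatever `l` is, so `l` may be compared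
with the identity. -/
theorem sum_card_filter_lt (l : Fin k ↪ Fin N) :
    ∑ i, #{a | l a < l i} = ∑ i : Fin k, (i : ℕ) := by
  have key : ∀ {M : ℕ} (l : Fin k ↪ Fin M), 2 * ∑ i, #{a | l a < l i} =
      ∑ i : Fin k, ∑ a : Fin k, if a ≠ i then 1 else 0 := by
    intro M l
    simp only [card_filter]
    rw [two_mul]
    nth_rewrite 2 [sum_comm]
    rw [← sum_add_distrib]
    refine sum_congr rfl fun i _ => ?_
    rw [← sum_add_distrib]
    refine sum_congr rfl fun a _ => ?_
    by_cases h : a = i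
    · simp [h]
    · rcases lt_or_gt_of_ne (l.injective.ne h) with h' | h' <;> simp [h, h', h'.not_gt]
  have h1 := key l
  have h2 := key (Function.Embedding.refl (Fin k))
  have h3 : ∀ i : Fin k, #{a | Function.Embedding.refl (Fin k) a <
      Function.Embedding.refl (Fin k) i} = i := by
    intro i
    have : (univ.filter fun a => Function.Embedding.refl (Fin k) a <
      Function.Embedding.refl (Fin k) i) = Iio i := by ext; simp
    rw [this, Fin.card_Iio]
  rw [sum_congr rfl fun i _ => h3 i] at h2
  exact Nat.eq_of_mul_eq_mul_left two_pos (h1.trans h2.symm)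

/-- Below `l i` there are `l i` indices, each either in the complement or in the tuple; the latter
number `∑ i` in total. The sum counts the inversions between the tuple and its complement. -/
theorem sum_card_compl_lt (l : Fin k ↪ Fin N) :
    ((∑ i, #{j ∈ compl l | j < l i} : ℕ) : ℤ) = ∑ i, (((l i : ℕ) : ℤ) - ((i : ℕ) : ℤ)) := by
  have h : ∀ i, #{j ∈ compl l | j < l i} + #{a | l a < l i} = l i := by
    intro i
    rw [← Fin.card_Iio (l i), ← card_map l, ← card_union_of_disjoint]
    · congr 1
      ext j
      simp only [compl, mem_union, mem_filter, mem_compl, mem_map, mem_univ, true_and, mem_Iio]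
      constructor
      · rintro (h | ⟨a, ha, rfl⟩)
        · exact h.2
        · exact ha
      · intro h
        by_cases hj : ∃ a, l a = j
        · obtain ⟨a, rfl⟩ := hj
          exact Or.inr ⟨a, h, rfl⟩
        · exact Or.inl ⟨hj, h⟩
    · rw [disjoint_left]
      intro j hj hj'
      obtain ⟨a, _, rfl⟩ := mem_map.1 hj'
      simp [compl] at hj
  have h1 : ∑ i, #{j ∈ compl l | j < l i} + ∑ i, #{a | l a < l i} = ∑ i, (l i : ℕ) := by
    rw [← sum_add_distrib]
    exact sum_congr rfl fun i _ => h i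
  rw [sum_card_filter_lt] at h1
  rw [sum_sub_distrib]
  have : ((∑ i, #{j ∈ compl l | j < l i} + ∑ i : Fin k, (i : ℕ) : ℕ) : ℤ) =
      (∑ i, (l i : ℕ) : ℕ) := by rw [h1]
  push_cast at this ⊢
  linarith

theorem sgn_eq_prod (l : Fin k ↪ Fin N) :
    sgn l = ∏ i, ∏ j ∈ Ioi i, if l j < l i then (-1 : ℂ) else 1 := by
  rw [sgn, ← prod_const, prod_filter, ← univ_product_univ, prod_product]
  refine prod_congr rfl fun i _ => ?_
  have : Ioi i = univ.filter fun j => i < j := by ext; simp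
  rw [this, prod_filter]
  refine prod_congr rfl fun j _ => ?_
  by_cases h : i < j <;> simp [h]

theorem sign_mul_vandermonde (hk : k ≤ N) (σ : Equiv.Perm (Fin N)) (ξ : Fin N → ℂ) :
    (-1 : ℂ) ^ (∑ i, (((restrict hk σ i : ℕ) : ℤ) - ((i : ℕ) : ℤ))) * sgn (restrict hk σ) *
        vandermonde (compl (restrict hk σ)) ξ =
      Equiv.Perm.sign σ * vandermonde (tail k) (ξ ∘ σ) := by
  set l := restrict hk σ with hl
  -- An antisymmetric function of pairs that is the Vandermonde factor inside the complement and the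
  -- sign of the order elsewhere. Its product over the pairs permuted by `σ` separates into
  -- inversions between tuple and complement, inversions within the tuple, and the Vandermonde
  -- product of the tail.
  set h : Fin N → Fin N → ℂ := fun a b =>
    if a ∈ compl l ∧ b ∈ compl l then ξ b - ξ a else if a < b then 1 else if b < a then -1 else 0
    with hdef
  have hanti : ∀ a b, h a b = -h b a := by
    intro a b
    simp only [hdef]
    by_cases hab : a ∈ compl l ∧ b ∈ compl l
    · rw [if_pos hab, if_pos ⟨hab.2, hab.1⟩]; ring
    · have hba : ¬(b ∈ compl l ∧ a ∈ compl l) := fun h' => hab ⟨h'.2, h'.1⟩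
      rw [if_neg hab, if_neg hba]
      rcases lt_trichotomy a b with h1 | h1 | h1
      · simp [h1, h1.not_gt]
      · simp [h1]
      · simp [h1, h1.not_gt]
  have key := σ.prod_Iio_comp_eq_sign_mul_prod (R := ℂ) hanti
  have e1 : ∏ j, ∏ i ∈ Iio j, h i j = vandermonde (compl l) ξ := by
    rw [vandermonde_eq_prod_Iio]
    refine prod_congr rfl fun j _ => prod_congr rfl fun i hi => ?_
    simp only [hdef]
    rw [if_pos (mem_Iio.1 hi)]
  have hnot : ∀ i, l i ∉ compl l := fun i => by simp [compl]
  have e2 : ∏ j, ∏ i ∈ Iio j, h (σ i) (σ j) =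
      (-1 : ℂ) ^ (∑ i, (((l i : ℕ) : ℤ) - ((i : ℕ) : ℤ))) * sgn l *
        vandermonde (tail k) (ξ ∘ σ) := by
    rw [prod_comm' (t' := univ) (s' := fun i => Ioi i) (by simp),
      ← prod_compl_mul_prod (tail k), prod_pairs_restrict hk, ← hl]
    congr 1
    · congr 1
      · rw [← sum_card_compl_lt, zpow_natCast, ← prod_pow_eq_pow_sum]
        refine prod_congr rfl fun i _ => ?_
        rw [← prod_const, prod_filter]
        refine prod_congr rfl fun j hj => ?_
        simp only [hdef]
        rw [if_neg fun h' => hnot i h'.1]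
        have hne : j ≠ l i := fun h' => hnot i (h' ▸ hj)
        rcases lt_or_gt_of_ne hne with h1 | h1 <;> simp [h1, h1.not_gt]
      · rw [sgn_eq_prod]
        refine prod_congr rfl fun i _ => prod_congr rfl fun j hj => ?_
        simp only [hdef]
        rw [if_neg fun h' => hnot i h'.1]
        have hne : l j ≠ l i := l.injective.ne (mem_Ioi.1 hj).ne'
        rcases lt_or_gt_of_ne hne with h1 | h1 <;> simp [h1, h1.not_gt]
    · rw [vandermonde]
      refine prod_congr rfl fun i hi => ?_
      have hmem : ∀ j ∈ tail (N := N) k, σ j ∈ compl l := fun j hj => by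
        rw [hl, compl_restrict]
        exact mem_map_of_mem _ hj
      have hset : (tail (N := N) k).filter (fun j => i < j) = Ioi i := by
        ext j
        rw [mem_filter, mem_Ioi, mem_tail]
        rw [mem_tail] at hi
        exact ⟨fun h => h.2, fun h => ⟨hi.trans (Fin.lt_def.1 h).le, h⟩⟩
      rw [hset]
      refine prod_congr rfl fun j hj => ?_
      simp only [hdef]
      rw [← hset] at hj
      rw [if_pos ⟨hmem i hi, hmem j (mem_filter.1 hj).1⟩]
      rfl
  rw [e1, e2] at key
  have hs := sign_mul_self σ
  have hs1 : sgn l * sgn l = 1 := by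
    rw [sgn, ← mul_pow]; simp
  have hs2 : (-1 : ℂ) ^ (∑ i, (((l i : ℕ) : ℤ) - ((i : ℕ) : ℤ))) *
      (-1 : ℂ) ^ (∑ i, (((l i : ℕ) : ℤ) - ((i : ℕ) : ℤ))) = 1 := by
    rw [← mul_zpow]; simp
  set s := (-1 : ℂ) ^ (∑ i, (((l i : ℕ) : ℤ) - ((i : ℕ) : ℤ)))
  set W := vandermonde (compl l) ξ
  set V := vandermonde (tail k) (ξ ∘ σ)
  set g : ℂ := (Equiv.Perm.sign σ : ℂ)
  calc s * sgn l * W = s * sgn l * g * (g * W) := by linear_combination -s * sgn l * W * hs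
    _ = s * sgn l * g * (s * sgn l * V) := by rw [key]
    _ = (s * s) * (sgn l * sgn l) * (g * V) := by ring
    _ = g * V := by rw [hs1, hs2]; ring

end embedding

/-! ### Assembling the formula for the probability. -/

section probability

variable {N k : ℕ} {p r : ℝ}

/-- The positions `x 0, …, x k, x k, x k, …`. -/
def extend (x : Fin (k + 1) → ℤ) (i : Fin N) : ℤ := x ⟨min i k, by omega⟩

/-- The positions `x 0, …, x (k - 1), x k + 1, x k + 1, …`. -/
def extendShift (x : Fin (k + 1) → ℤ) (i : Fin N) : ℤ :=
  if k ≤ i then extend x i + 1 else extend x i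

theorem prod_zpow_extend (hk : k ≤ N) (x : Fin (k + 1) → ℤ) (σ : Equiv.Perm (Fin N))
    (ξ : Fin N → ℂ) : ∏ i, ξ (σ i) ^ extend x i =
      (∏ i, ξ (restrict hk σ i) ^ x i.castSucc) *
        ∏ j ∈ compl (restrict hk σ), ξ j ^ x (Fin.last k) := by
  rw [← prod_compl_mul_prod (tail k), compl_tail_eq_map hk, prod_map, prod_compl_restrict]
  congr 1
  · refine prod_congr rfl fun i _ => ?_
    have : extend x (Fin.castLEEmb hk i) = x i.castSucc := by
      unfold extend
      congr 1
      ext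
      simp [i.isLt.le]
    rw [this]
    rfl
  · refine prod_congr rfl fun i hi => ?_
    have : extend x i = x (Fin.last k) := by
      unfold extend
      congr 1
      ext
      simpa [mem_tail] using hi
    rw [this]

/-- The factor `1 - ∏ ξ_j` of the integrand is the difference of two Bethe functions whose tail
positions differ by one; the signs are matched by `sign_mul_vandermonde`. -/
theorem integrand_restrict (hk : k ≤ N) (p : ℝ) (y : Fin N → ℤ) (x : Fin (k + 1) → ℤ) (t : ℝ)
    (σ : Equiv.Perm (Fin N)) {ξ : Fin N → ℂ} (h0 : ∀ i, ξ i ≠ 0) :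
    (-1 : ℂ) ^ (∑ i, (((restrict hk σ i : ℕ) : ℤ) - ((i : ℕ) : ℤ))) * sgn (restrict hk σ) *
        (p : ℂ) ^ ((N - k) * (N - k - 1) / 2) * integrand p y x t (restrict hk σ) ξ =
      Equiv.Perm.sign σ *
          (bethe p k (extend x) (ξ ∘ σ) - bethe p k (extendShift x) (ξ ∘ σ)) / pairProd p ξ *
        (∏ i, ξ i ^ (-y i - 1)) * Complex.exp ((∑ i, ε p (ξ i)) * t) := by
  rw [bethe_add_indicator p k (x := extend x) (x' := extendShift x) (fun _ => rfl)
    (ζ := ξ ∘ σ) fun i => h0 (σ i)]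
  have hv := sign_mul_vandermonde hk σ ξ
  have hf := prod_pairs_restrict hk σ fun a b => f p (ξ a) (ξ b)
  have hc := prod_compl_restrict hk σ fun j => ξ j
  have hd := prod_compl_restrict hk σ fun j => 1 - ξ j
  have hz := prod_zpow_extend hk x σ ξ
  simp only [integrand, bethe, Function.comp_apply]
  rw [hf, ← hc, ← hd, hz]
  have e1 : ∏ i ∈ compl (restrict hk σ), ∏ j ∈ compl (restrict hk σ) with i < j, (ξ j - ξ i) =
    vandermonde (compl (restrict hk σ)) ξ := rfl
  have e2 : ∏ i, ∏ j ∈ Ioi i, f p (ξ i) (ξ j) = pairProd p ξ := rfl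
  rw [e1, e2]
  linear_combination ((∏ i, ∏ j ∈ compl (restrict hk σ), f p (ξ (restrict hk σ i)) (ξ j)) *
    (∏ i, ∏ j ∈ Ioi i, f p (ξ (restrict hk σ i)) (ξ (restrict hk σ j))) / pairProd p ξ *
    (p : ℂ) ^ ((N - k) * (N - k - 1) / 2) * (1 - ∏ j ∈ compl (restrict hk σ), ξ j) /
    (∏ j ∈ compl (restrict hk σ), (1 - ξ j)) * (∏ i, ξ (restrict hk σ i) ^ x i.castSucc) *
    (∏ j ∈ compl (restrict hk σ), ξ j ^ x (Fin.last k)) * (∏ i, ξ i ^ (-y i - 1)) *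
    Complex.exp ((∑ i, ε p (ξ i)) * t)) * hv

/-- The positions `x 0, …, x k, x k + 1, x k + 1, …`. -/
def extendNext (x : Fin (k + 1) → ℤ) (i : Fin N) : ℤ :=
  if k < i then extend x i + 1 else extend x i

theorem sum_contour_integrand (hp : p ≠ 0) (hr : SmallRadius p r) (hk : k + 1 ≤ N)
    (y : Fin N → ℤ) (x : Fin (k + 1) → ℤ) (t : ℝ) :
    ((N - (k + 1))! : ℂ) * ∑ l : Fin k ↪ Fin N,
        (-1 : ℂ) ^ (∑ i, (((l i : ℕ) : ℤ) - ((i : ℕ) : ℤ))) * sgn l *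
          (p : ℂ) ^ ((N - k) * (N - k - 1) / 2) * contour r (integrand p y x t l) =
      contour r fun ξ => asym (bethe p (k + 1) (extendNext x)) ξ / pairProd p ξ *
        (∏ i, ξ i ^ (-y i - 1)) * Complex.exp ((∑ i, ε p (ξ i)) * t) := by
  have hk' : k ≤ N := by omega
  have hfac : ((N - k)! : ℂ) = (N - k : ℕ) * ((N - (k + 1))! : ℂ) := by
    rw [show N - k = N - (k + 1) + 1 by omega, Nat.factorial_succ]
    push_cast
    rfl
  have hne : ((N - k : ℕ) : ℂ) ≠ 0 := Nat.cast_ne_zero.2 (by omega)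
  have hexp : ContinuousOn (fun ξ : Fin N → ℂ => Complex.exp ((∑ i, ε p (ξ i)) * t))
      (torus N r) := by
    refine ContinuousOn.cexp (ContinuousOn.mul (continuousOn_finsetSum _ fun i _ => ?_)
      continuousOn_const)
    have := hr.continuousOn_inv (N := N) i
    unfold ε
    fun_prop
  -- The extra factor `N - k` turns `(N - k - 1)!` into `(N - k)!`, the number of permutations over
  -- each tuple. It is also the factor that `asym_bethe_sub` produces on the other side.
  apply mul_left_cancel₀ hne
  rw [← mul_assoc, ← hfac, ← sum_perm_restrict hk', ← contour_const_mul]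
  have h1 : ∀ σ : Equiv.Perm (Fin N),
      (-1 : ℂ) ^ (∑ i, (((restrict hk' σ i : ℕ) : ℤ) - ((i : ℕ) : ℤ))) * sgn (restrict hk' σ) *
        (p : ℂ) ^ ((N - k) * (N - k - 1) / 2) *
          contour r (integrand p y x t (restrict hk' σ)) =
      contour r fun ξ => Equiv.Perm.sign σ *
          (bethe p k (extend x) (ξ ∘ σ) - bethe p k (extendShift x) (ξ ∘ σ)) / pairProd p ξ *
        (∏ i, ξ i ^ (-y i - 1)) * Complex.exp ((∑ i, ε p (ξ i)) * t) := by
    intro σ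
    rw [← contour_const_mul]
    exact contour_congr hr.pos.le fun ξ hξ =>
      integrand_restrict hk' p y x t σ fun i => hr.ne_zero hξ i
  rw [sum_congr rfl fun σ _ => h1 σ, ← contour_sum hr.pos.le]
  · refine contour_congr hr.pos.le fun ξ hξ => ?_
    have h2 := asym_bethe_sub (p := p) hp (k := ⟨k, hk⟩) (x := extend x)
      (x' := extendNext x) (x'' := extendShift x) (ξ := ξ) (fun i hi => ?_) (fun i => ?_)
      (fun i => ?_) (fun i => hr.ne_zero hξ i) (fun i => hr.ne_one hξ i)
    · simp only [← sum_mul, ← sum_div]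
      simp only [asym, ← sum_sub_distrib, ← mul_sub] at h2
      rw [h2]
      simp only [asym]
      ring
    · rw [mem_tail] at hi
      unfold extend
      congr 2
      simp only at hi ⊢
      omega
    · rfl
    · rfl
  · intro σ _
    refine ContinuousOn.mul (hr.continuousOn_kernel (continuousOn_const.mul ?_) y) hexp
    exact ContinuousOn.sub (ContinuousOn.comp_perm (hr.continuousOn_bethe k _) σ)
      (ContinuousOn.comp_perm (hr.continuousOn_bethe k _) σ)

theorem transform_asym_bethe_extendNext (hp : p ≠ 0) (hr : SmallRadius p r) (hk : k + 1 ≤ N)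
    (Y : Config N) (x : Fin (k + 1) → ℤ) (hx : StrictMono x) :
    transform p r (asym (bethe p (k + 1) (extendNext x))) Y.1 =
      ((N - (k + 1))! : ℂ) * if ∀ i, Y.1 (Fin.castLE hk i) = x i then 1 else 0 := by
  have hle : ∀ i : Fin N, (i : ℕ) ≤ k → ∀ h : (i : ℕ) < k + 1,
      extendNext x i = x ⟨i, h⟩ := by
    intro i hi h
    rw [extendNext, if_neg (not_lt.2 hi), extend]
    congr 2
    exact min_eq_left hi
  have hgt : ∀ i : Fin N, k < i → extendNext x i = x (Fin.last k) + 1 := by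
    intro i hi
    rw [extendNext, if_pos hi, extend]
    congr 2
    ext
    exact min_eq_right hi.le
  rw [transform_asym_bethe hp hr Y.2 hk]
  · congr 1
    refine if_congr ?_ rfl rfl
    constructor
    · intro h i
      have := h (Fin.castLE hk i)
      have hi : (Fin.castLE hk i : ℕ) < k + 1 := i.isLt
      rw [if_pos hi, hle _ (Nat.lt_succ_iff.1 hi) hi] at this
      exact this.symm
    · intro h i
      by_cases hi : (i : ℕ) < k + 1
      · rw [if_pos hi, hle i (by omega) hi, ← h]
        rfl
      · rw [if_neg hi, hgt i (by omega), ← h]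
        exact Y.2 (Fin.lt_def.2 (by simp; omega))
  · intro i j hi hij
    rw [hle i (by omega) hi]
    rw [Fin.lt_def] at hij
    by_cases hj : (j : ℕ) < k + 1
    · rw [hle j (by omega) hj]
      exact hx (Fin.lt_def.2 hij)
    · rw [hgt j (by omega)]
      exact Int.lt_add_one_of_le (hx.monotone (Fin.le_last _))
  · intro i j hi hj
    rw [hgt i hi, hgt j hj]

/-- The factor `(∑ ε(ξ_i)) ^ n` is symmetric, so the integrand stays antisymmetric and the boundary
conditions persist; each application of the generator then multiplies by the eigenvalue. -/
theorem iterate_generator_eq_transform (hp : p ≠ 0) (hr : SmallRadius p r) (hk : k + 1 ≤ N)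
    (x : Fin (k + 1) → ℤ) (hx : StrictMono x) (n : ℕ) (Y : Config N) :
    ((N - (k + 1))! : ℂ) * (((generator p)^[n]
        (fun W => if ∀ i, W.1 (Fin.castLE hk i) = x i then 1 else 0) Y : ℝ) : ℂ) =
      transform p r (fun ξ => (∑ i, ε p (ξ i)) ^ n *
        asym (bethe p (k + 1) (extendNext x)) ξ) Y.1 := by
  induction n generalizing Y with
  | zero =>
    simp only [pow_zero, one_mul, Function.iterate_zero, id_eq]
    rw [show (fun ξ => asym (bethe p (k + 1) (extendNext x)) ξ) =
      asym (bethe p (k + 1) (extendNext x (N := N))) from rfl,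
      transform_asym_bethe_extendNext hp hr hk Y x hx]
    congr 1
    split_ifs <;> simp
  | succ n ih =>
    obtain ⟨M, rfl⟩ : ∃ M, N = M + 1 := ⟨N - 1, by omega⟩
    set G : (Fin (M + 1) → ℂ) → ℂ := fun ξ => (∑ i, ε p (ξ i)) ^ n *
        asym (bethe p (k + 1) (extendNext x)) ξ with hGdef
    have hG : ContinuousOn G (torus (M + 1) r) := by
      refine ContinuousOn.mul (ContinuousOn.pow (continuousOn_finsetSum _ fun i _ => ?_) _)
        (continuousOn_asym (hr.continuousOn_bethe _ _))
      have := hr.continuousOn_inv (N := M + 1) i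
      unfold ε
      fun_prop
    have hfac : ((M + 1 - (k + 1))! : ℂ) ≠ 0 := Nat.cast_ne_zero.2 (Nat.factorial_ne_zero _)
    rw [Function.iterate_succ_apply',
      generator_eq_sum_free p Y _ (fun Z => ((M + 1 - (k + 1))! : ℂ)⁻¹ * transform p r G Z)]
    · have hsucc : (fun ξ : Fin (M + 1) → ℂ => (∑ i, ε p (ξ i)) ^ (n + 1) *
          asym (bethe p (k + 1) (extendNext x)) ξ) = fun ξ => (∑ i, ε p (ξ i)) * G ξ := by
        ext ξ
        rw [pow_succ', mul_assoc]
      rw [hsucc, ← sum_free_transform hr hG, mul_sum]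
      refine sum_congr rfl fun i _ => ?_
      field_simp
    · intro Z
      rw [← ih Z, inv_mul_cancel_left₀ hfac]
    · intro j hj
      have hanti : ∀ ξ ∈ torus (M + 1) r, G (ξ ∘ Equiv.swap j.castSucc j.succ) = -G ξ := by
        intro ξ _
        simp only [hGdef]
        rw [asym_comp, Equiv.Perm.sign_swap (Fin.castSucc_lt_succ).ne]
        have : ∑ i, ε p ((ξ ∘ Equiv.swap j.castSucc j.succ) i) = ∑ i, ε p (ξ i) :=
          Equiv.sum_comp (Equiv.swap j.castSucc j.succ) fun i => ε p (ξ i)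
        rw [this]
        push_cast
        ring
      have := transform_boundary hr hG (c := j.castSucc) (s := j.succ) (by simp) hanti hj
      linear_combination ((M + 1 - (k + 1))! : ℂ)⁻¹ * this

end probability

end ASEP

theorem theorem1 (p : ℝ) (hp0 : 0 < p) (hp1 : p ≤ 1)
    -- `N` particles, of which the first `m = k + 1` are observed
    (N k : ℕ) (hk : k + 1 ≤ N) (Y : ASEP.Config N)
    {Ω : Type*} [MeasurableSpace Ω] (P : MeasureTheory.Measure Ω)
    [MeasureTheory.IsProbabilityMeasure P]
    (X : ℝ≥0 → Ω → ASEP.Config N) (hX : ASEP.IsASEP p Y P X)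
    (x : Fin (k + 1) → ℤ) (hx : StrictMono x) (t : ℝ≥0)
    -- all nonzero poles of the integrands lie outside the circle of radius `r`
    (r : ℝ) (hr0 : 0 < r) (hr1 : r < 1)
    (hr : ∀ ξ ξ' : ℂ, ‖ξ‖ ≤ r → ‖ξ'‖ ≤ r → ASEP.f p ξ ξ' ≠ 0) :
    ((P.real {ω | ∀ i : Fin (k + 1), (X t ω).1 (Fin.castLE hk i) = x i} : ℝ) : ℂ) =
        ∑ l : Fin k ↪ Fin N,
          (-1 : ℂ) ^ (∑ i, (((l i : ℕ) : ℤ) - ((i : ℕ) : ℤ))) * ASEP.sgn l *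
            (p : ℂ) ^ ((N - k) * (N - k - 1) / 2) *
            ASEP.contour r (ASEP.integrand p Y.1 x t l) ∧
      -- the number of terms of this sum is `N! / (N - m + 1)!`
      Fintype.card (Fin k ↪ Fin N) * (N - k)! = N ! := by
  refine ⟨?_, ASEP.card_embedding_mul_factorial (by omega)⟩
  classical
  have hs : ASEP.SmallRadius p r := ⟨hr0, hr1, hr⟩
  have hfac : ((N - (k + 1))! : ℂ) ≠ 0 := Nat.cast_ne_zero.2 (Nat.factorial_ne_zero _)
  apply mul_left_cancel₀ hfac
  rw [ASEP.sum_contour_integrand hp0.ne' hs hk]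
  set A : Set (ASEP.Config N) := {W | ∀ i, W.1 (Fin.castLE hk i) = x i} with hA
  have h1 : P.real {ω | ∀ i : Fin (k + 1), (X t ω).1 (Fin.castLE hk i) = x i} =
      ∑' Z, (if Z ∈ A then 1 else 0) * ASEP.transition p t Y Z := ASEP.prob_mem hX t A
  have h2 := ASEP.hasSum_transition hp0.le hp1 (t : ℝ) A Y
  rw [← h1] at h2
  have h3 := (Complex.hasSum_ofReal.2 h2).mul_left ((N - (k + 1))! : ℂ)
  -- The probability and the contour integral are sums of exponential series in `t`, which are
  -- compared term by term.
  refine h3.unique ?_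
  have hcont : ContinuousOn (fun ξ : Fin N → ℂ => ∑ i, ASEP.ε p (ξ i)) (ASEP.torus N r) := by
    refine continuousOn_finsetSum _ fun i _ => ?_
    have := hs.continuousOn_inv (N := N) i
    unfold ASEP.ε
    fun_prop
  have h4 := ASEP.hasSum_contour_exp hr0.le (hs.continuousOn_kernel
    (ASEP.continuousOn_asym (hs.continuousOn_bethe (k + 1) (ASEP.extendNext x))) Y.1) hcont t
  refine (congrArg (HasSum · _) (funext fun n => ?_)).mpr h4
  have h5 := ASEP.iterate_generator_eq_transform hp0.ne' hs hk x hx n Y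
  have h6 : ASEP.transform p r (fun ξ => (∑ i, ASEP.ε p (ξ i)) ^ n *
      ASEP.asym (ASEP.bethe p (k + 1) (ASEP.extendNext x)) ξ) Y.1 =
      ASEP.contour r fun ξ => (∑ i, ASEP.ε p (ξ i)) ^ n *
        (ASEP.asym (ASEP.bethe p (k + 1) (ASEP.extendNext x)) ξ / ASEP.pairProd p ξ *
          ∏ i, ξ i ^ (-Y.1 i - 1)) :=
    ASEP.contour_congr hr0.le fun ξ _ => by ring
  rw [← h6, ← h5, Complex.ofReal_mul]
  simp only [hA, Set.mem_ofPred_eq]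
  ring
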